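/- All graphs are finite, undirected and simple. A graph is $K_5$-minor-free if it does not contain five pairwise disjoint nonempty vertex sets, each inducing a connected subgraph, with an edge between every two of them. Let $G$ be a $K_5$-minor-free graph and let $A\subseteq B\subseteq V(G)$, where $A$ is a clique of $G$ and the graph obtained from $G$ by adding one new vertex adjacent to exactly the vertices in $B$ is also $K_5$-minor-free (that is, $B$ is an $\mathcal{M}$-boundary of $G$, where $\mathcal{M}$ is the class of $K_5$-minor-free graphs). Let $L$ assign to each vertex $x$ of $G$ a set $L(x)$ of colours such that - $|L(x)|=1$ for each $x\in A$, - $L(x)\neq L(y)$ for all distinct $x,y\in A$, - $|L(x)|\geq 3$ for each $x\in B\setminus A$, - $|L(x)|\geq 5$ for each $x\in V(G)\setminus B$. Then $G$ is $L$-colourable: one can choose a colour $c(x)\in L(x)$ for every vertex $x$ of $G$ so that $c(x)\neq c(y)$ whenever $xy$ is an edge of $G$. -/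

import Mathlib

universe u v w

namespace SimpleGraph

/-- `H` is a minor of `G`: there is a model of `H` in `G`, that is, a family of pairwise disjoint
vertex sets of `G` (the branch sets) indexed by the vertices of `H`, each inducing a connected
(in particular nonempty) subgraph of `G`, such that for each edge of `H` there is an edge of `G`
between the two corresponding branch sets. -/
def IsMinor {W : Type w} {V : Type v} (H : SimpleGraph W) (G : SimpleGraph V) : Prop :=
  ∃ branch : W → Set V,
    (∀ i, (G.induce (branch i)).Connected) ∧
    (∀ i j, i ≠ j → Disjoint (branch i) (branch j)) ∧
    (∀ i j, H.Adj i j → ∃ x ∈ branch i, ∃ y ∈ branch j, G.Adj x y)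

/-- A class of graphs. -/
abbrev GraphClass : Type (u + 1) := ∀ ⦃V : Type u⦄, SimpleGraph V → Prop

/-- The class of graphs that do not have the complete graph on `t` vertices as a minor. -/
def completeMinorFree (t : ℕ) : GraphClass.{u} :=
  fun _ G => ¬ IsMinor (completeGraph (Fin t)) G

/-- The graph obtained from `G` by adding a new vertex `none`, adjacent to exactly the
vertices in `B`. -/
def plus {V : Type u} (G : SimpleGraph V) (B : Set V) : SimpleGraph (Option V) where
  Adj
    | some x, some y => G.Adj x y
    | none, some y => y ∈ B
    | some x, none => x ∈ B
    | none, none => False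
  symm := ⟨by
    rintro (_ | x) (_ | y) h
    · exact h
    · exact h
    · exact h
    · exact SimpleGraph.Adj.symm (G := G) h⟩
  loopless := ⟨by
    rintro (_ | x) h
    · exact h
    · exact G.loopless.irrefl x h⟩

/-- For a class `M` of graphs and a graph `G` in `M`, the set `B` of vertices is an
`M`-boundary of `G` if adding a new vertex adjacent to exactly `B` gives a graph in `M`. -/
def IsBoundary (M : GraphClass.{u}) {V : Type u} (G : SimpleGraph V) (B : Set V) : Prop :=
  M G ∧ M (G.plus B)

/-- `G` is `L`-colourable: it has a proper colouring that gives each vertex `x` a colour of the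
list `L x`. -/
def ListColourable {V : Type u} {C : Type v} (G : SimpleGraph V) (L : V → Set C) : Prop :=
  ∃ c : G.Coloring C, ∀ x, c x ∈ L x

end SimpleGraph

/-! The proof is by induction on the number of vertices, in the manner of Thomassen's list-colouring
proof for planar graphs; the boundary plays the part of the outer face. When vertices are deleted or
a side of a separation is coloured alone, the smaller graph with its added vertex is shown to be a
minor of `G.plus B`, so it is again an instance (`ColourableBelow.exists_colouring_on`).

Consider an instance that is not colourable although all smaller ones are. Precolouring boundary
vertices brings the problem to the case of at least two vertices in `A`. Each precoloured vertex has
a neighbour in `B \ A`, since otherwise it could be deleted (`colourable_of_mem`). There is no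
separator of order at most two: the side containing `A` would be coloured first, and the other side
then with the separator as its precoloured clique (`colourable_of_models`).

Without small separators, a set `Z ⊆ B` of at least three vertices in which any three vertices root
a triangle minor must contain all of `B`: for `b ∈ B` outside `Z`, the component of `b` off `Z`
attaches to three vertices of `Z`, and the rooted triangle, this component and the added vertex form
a `K₅` minor (`subset_of_isTriangleRooted`). Cycles are such sets.

Applied to a triangle on two precoloured vertices `a₁`, `a₂` and a common neighbour in `B`, this
makes `B` so small that the instance is colourable. So there is no such neighbour and `A = {a₁,
a₂}`. Now each vertex of `B \ A` has at most one neighbour in `A`, hence at least two in `B \ A`, as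
otherwise it could be deleted after reserving two of its colours (`colourable_of_few_neighbours`).
Thus `B \ A` contains a cycle, which must contain `B` and so `a₁`, a contradiction. -/

namespace SimpleGraph

/-! ### Connected vertex sets, minor models and branching. -/

section Connectivity

variable {W : Type*} {Γ : SimpleGraph W}

/-- There is an edge of `Γ` between `s` and `t`. -/
def Touches (Γ : SimpleGraph W) (s t : Set W) : Prop :=
  ∃ x ∈ s, ∃ y ∈ t, Γ.Adj x y

theorem Touches.symm {s t : Set W} (h : Γ.Touches s t) : Γ.Touches t s := by
  obtain ⟨x, hx, y, hy, hxy⟩ := h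
  exact ⟨y, hy, x, hx, hxy.symm⟩

theorem Touches.mono {s t s' t' : Set W} (h : Γ.Touches s t) (hs : s ⊆ s') (ht : t ⊆ t') :
    Γ.Touches s' t' := by
  obtain ⟨x, hx, y, hy, hxy⟩ := h
  exact ⟨x, hs hx, y, ht hy, hxy⟩

theorem Touches.connected_union {s t : Set W} (h : Γ.Touches s t)
    (hs : (Γ.induce s).Connected) (ht : (Γ.induce t).Connected) :
    (Γ.induce (s ∪ t)).Connected := by
  obtain ⟨x, hx, y, hy, hxy⟩ := h
  exact connected_induce_union hs.preconnected ht.preconnected hx hy hxy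

theorem connected_induce_singleton (Γ : SimpleGraph W) (x : W) :
    (Γ.induce ({x} : Set W)).Connected := by
  have : Nonempty ({x} : Set W) := ⟨⟨x, rfl⟩⟩
  exact ⟨fun a b => by rw [Subsingleton.elim a b]⟩

theorem nonempty_of_connected_induce {s : Set W} (h : (Γ.induce s).Connected) : s.Nonempty :=
  Set.nonempty_coe_sort.mp h.nonempty

/-- A property of some but not all vertices of a connected set changes along some edge. -/
theorem exists_adj_of_connected_induce {s t : Set W} (h : (Γ.induce s).Connected) {x y : W}
    (hx : x ∈ s) (hxt : x ∈ t) (hy : y ∈ s) (hyt : y ∉ t) :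
    ∃ a ∈ s, a ∈ t ∧ ∃ b ∈ s, b ∉ t ∧ Γ.Adj a b := by
  by_contra! hcon
  have key : ∀ z : s, Relation.ReflTransGen (Γ.induce s).Adj ⟨x, hx⟩ z → z.1 ∈ t := by
    intro z hz
    induction hz with
    | refl => exact hxt
    | tail _ hab ih =>
      by_contra hb
      exact hcon _ (Subtype.property _) ih _ (Subtype.property _) hb hab
  exact hyt (key ⟨y, hy⟩ ((reachable_iff_reflTransGen _ _).mp (h.preconnected _ _)))

theorem connected_induce_biUnion {W' : Type*} {Γ' : SimpleGraph W'} {s : Set W'}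
    (hs : (Γ'.induce s).Connected) (T : W' → Set W)
    (hT : ∀ w ∈ s, (Γ.induce (T w)).Connected)
    (hadj : ∀ w ∈ s, ∀ w' ∈ s, Γ'.Adj w w' → Γ.Touches (T w) (T w')) :
    (Γ.induce (⋃ w ∈ s, T w)).Connected := by
  obtain ⟨w₀, hw₀⟩ := nonempty_of_connected_induce hs
  obtain ⟨u, hu⟩ := nonempty_of_connected_induce (hT w₀ hw₀)
  have key : ∀ w : s, Relation.ReflTransGen (Γ'.induce s).Adj ⟨w₀, hw₀⟩ w →
      ∃ s' ⊆ ⋃ w ∈ s, T w, u ∈ s' ∧ T w ⊆ s' ∧ (Γ.induce s').Connected := by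
    intro w hw
    induction hw with
    | refl => exact ⟨T w₀, Set.subset_biUnion_of_mem hw₀, hu, subset_rfl, hT _ hw₀⟩
    | @tail b c _ hbc ih =>
      obtain ⟨s', hs', hus', hbs', hcon⟩ := ih
      refine ⟨s' ∪ T c, Set.union_subset hs' (Set.subset_biUnion_of_mem c.2), Or.inl hus',
        Set.subset_union_right, ?_⟩
      exact ((hadj b b.2 c c.2 hbc).mono hbs' subset_rfl).connected_union hcon (hT c c.2)
  refine induce_connected_of_patches u (Set.mem_biUnion hw₀ hu) ?_
  intro v hv
  obtain ⟨w, hw, hvw⟩ := Set.mem_iUnion₂.mp hv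
  obtain ⟨s', hs', hus', hws', hcon⟩ :=
    key ⟨w, hw⟩ ((reachable_iff_reflTransGen _ _).mp (hs.preconnected _ _))
  exact ⟨s', hs', hus', hws' hvw, hcon.preconnected _ _⟩

/-- A minor of a minor is a minor. -/
theorem IsMinor.trans_model {X W' : Type*} {H : SimpleGraph X} {Γ' : SimpleGraph W'}
    (h : IsMinor H Γ') (T : W' → Set W) (hT : ∀ w, (Γ.induce (T w)).Connected)
    (hdisj : ∀ w w', w ≠ w' → Disjoint (T w) (T w'))
    (hadj : ∀ w w', Γ'.Adj w w' → Γ.Touches (T w) (T w')) : IsMinor H Γ := by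
  obtain ⟨b, hb, hbd, hba⟩ := h
  refine ⟨fun i => ⋃ w ∈ b i, T w, fun i => ?_, fun i j hij => ?_, fun i j hij => ?_⟩
  · exact connected_induce_biUnion (hb i) T (fun w _ => hT w) (fun w _ w' _ h => hadj w w' h)
  · rw [Set.disjoint_left]
    intro x hx hx'
    obtain ⟨w, hw, hxw⟩ := Set.mem_iUnion₂.mp hx
    obtain ⟨w', hw', hxw'⟩ := Set.mem_iUnion₂.mp hx'
    by_cases hww : w = w'
    · subst hww
      exact Set.disjoint_left.mp (hbd i j hij) hw hw'
    · exact Set.disjoint_left.mp (hdisj w w' hww) hxw hxw'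
  · obtain ⟨x, hx, y, hy, hxy⟩ := hba i j hij
    exact (hadj x y hxy).mono (Set.subset_biUnion_of_mem hx) (Set.subset_biUnion_of_mem hy)

/-- The component of a vertex in an induced subgraph. -/
theorem exists_component (Γ : SimpleGraph W) {D : Set W} {a : W} (ha : a ∈ D) :
    ∃ K ⊆ D, a ∈ K ∧ (Γ.induce K).Connected ∧ ∀ x ∈ K, ∀ y ∈ D, Γ.Adj x y → y ∈ K := by
  refine ⟨{x | ∃ s ⊆ D, a ∈ s ∧ x ∈ s ∧ (Γ.induce s).Connected}, ?_, ?_, ?_, ?_⟩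
  · rintro x ⟨s, hs, -, hx, -⟩
    exact hs hx
  · exact ⟨{a}, by simpa using ha, rfl, rfl, connected_induce_singleton _ _⟩
  · refine induce_connected_of_patches a
      ⟨{a}, by simpa using ha, rfl, rfl, connected_induce_singleton _ _⟩ ?_
    rintro x ⟨s, hs, has, hxs, hcon⟩
    exact ⟨s, fun y hy => ⟨s, hs, has, hy, hcon⟩, has, hxs, hcon.preconnected _ _⟩
  · rintro x ⟨s, hs, has, hxs, hcon⟩ y hy hxy
    refine ⟨s ∪ {y}, Set.union_subset hs (by simpa using hy), Or.inl has, Or.inr rfl, ?_⟩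
    exact Touches.connected_union ⟨x, hxs, y, rfl, hxy⟩ hcon (connected_induce_singleton _ _)

/-- A connected set with at least two vertices has a vertex whose removal leaves it connected. -/
theorem exists_connected_induce_diff_singleton [Finite W] {D : Set W}
    (hD : (Γ.induce D).Connected) (hn : D.Nontrivial) :
    ∃ w ∈ D, (Γ.induce (D \ {w})).Connected := by
  have : Nontrivial D := Set.nontrivial_coe_sort.mpr hn
  obtain ⟨w, hw⟩ := hD.exists_connected_induce_compl_singleton_of_finite_nontrivial
  refine ⟨w, w.2, ?_⟩
  refine hw.map (⟨fun x => ⟨x.1.1, x.1.2, fun h => x.2 (Subtype.ext h)⟩, fun h => h⟩ :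
    (Γ.induce D).induce {w}ᶜ →g Γ.induce (D \ {w.1})) ?_
  rintro ⟨x, hx, hxw⟩
  exact ⟨⟨⟨x, hx⟩, fun h => hxw (congrArg Subtype.val h)⟩, rfl⟩

/-- Three connected sets, each touching a connected set `D` disjoint from them, can be enlarged
inside `D` so that all of them become adjacent to one vertex of `D`. -/
theorem exists_branching_vertex [Finite W] (n : ℕ) : ∀ (D : Set W) (T : Fin 3 → Set W),
    D.ncard = n → (Γ.induce D).Connected → (∀ i, (Γ.induce (T i)).Connected) →
    (∀ i j, i ≠ j → Disjoint (T i) (T j)) → (∀ i, Disjoint (T i) D) →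
    (∀ i, Γ.Touches D (T i)) →
    ∃ m ∈ D, ∃ T' : Fin 3 → Set W,
      (∀ i, T i ⊆ T' i ∧ T' i ⊆ T i ∪ D ∧ m ∉ T' i ∧ (Γ.induce (T' i)).Connected ∧
        Γ.Touches {m} (T' i)) ∧ ∀ i j, i ≠ j → Disjoint (T' i) (T' j) := by
  induction n using Nat.strong_induction_on with
  | _ n ih =>
  intro D T hn hD hT hTT hTD hDT
  by_cases hnt : D.Nontrivial
  swap
  · obtain ⟨m, hm⟩ := nonempty_of_connected_induce hD
    obtain rfl : D = {m} := by
      rw [Set.not_nontrivial_iff] at hnt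
      exact hnt.eq_singleton_of_mem hm
    exact ⟨m, rfl, T, fun i => ⟨subset_rfl, Set.subset_union_left,
      fun h => Set.disjoint_left.mp (hTD i) h rfl, hT i, hDT i⟩, hTT⟩
  -- Peel off a non-cut vertex `w` of `D`. Every `T i` that the rest `E` does not touch is touched
  -- by `w`.
  obtain ⟨w, hw, hE⟩ := exists_connected_induce_diff_singleton hD hnt
  set E := D \ {w} with hEdef
  have hED : E ⊆ D := Set.sdiff_subset
  have hwE : w ∉ E := fun h => h.2 rfl
  have hwT : ∀ i, w ∉ T i := fun i h => Set.disjoint_left.mp (hTD i) h hw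
  have hEn : E.ncard < n := hn ▸ Set.ncard_sdiff_singleton_lt_of_mem hw
  have hsees : ∀ i, ¬ Γ.Touches E (T i) → Γ.Touches {w} (T i) := by
    rintro i hi
    obtain ⟨x, hx, y, hy, hxy⟩ := hDT i
    by_cases hxw : x = w
    · exact ⟨x, hxw, y, hy, hxy⟩
    · exact absurd ⟨x, ⟨hx, hxw⟩, y, hy, hxy⟩ hi
  have hwE' : Γ.Touches {w} E := by
    obtain ⟨e, he⟩ := nonempty_of_connected_induce hE
    obtain ⟨a, -, hat, b, hb, hbt, hab⟩ :=
      exists_adj_of_connected_induce (t := {w}) hD hw rfl (hED he) (fun h => hwE (h ▸ he))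
    exact ⟨a, hat, b, ⟨hb, hbt⟩, hab⟩
  -- If `E` misses at most one `T i`, recurse into `E`; a missed `T i` first absorbs `w`, through
  -- which it touches `E`.
  by_cases hcase : ∃ i, ∀ j, j ≠ i → Γ.Touches E (T j)
  · obtain ⟨i, hi⟩ := hcase
    by_cases hi' : Γ.Touches E (T i)
    · obtain ⟨m, hm, T', hT', hd⟩ := ih _ hEn E T rfl hE hT hTT
        (fun j => (hTD j).mono_right hED)
        (fun j => by by_cases h : j = i <;> [exact h ▸ hi'; exact hi j h])
      exact ⟨m, hED hm, T', fun j => ⟨(hT' j).1,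
        (hT' j).2.1.trans (Set.union_subset_union_right _ hED), (hT' j).2.2⟩, hd⟩
    · have hwi := hsees i hi'
      obtain ⟨m, hm, T', hT', hd⟩ := ih _ hEn E (Function.update T i ({w} ∪ T i)) rfl hE
        (fun j => by
          by_cases h : j = i
          · subst h
            rw [Function.update_self]
            exact hwi.connected_union (connected_induce_singleton _ _) (hT j)
          · rw [Function.update_of_ne h]
            exact hT j)
        (fun j k hjk => by
          by_cases h : j = i
          · subst h
            simpa [Function.update_of_ne hjk.symm, hwT] using hTT j k hjk
          · by_cases h' : k = i
            · subst h'
              simpa [Function.update_of_ne hjk, hwT] using hTT j k hjk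
            · simpa [h, h'] using hTT j k hjk)
        (fun j => by
          by_cases h : j = i
          · subst h
            simpa [hwE] using (hTD j).mono_right hED
          · simpa [h] using (hTD j).mono_right hED)
        (fun j => by
          by_cases h : j = i
          · subst h
            simpa using hwE'.symm.mono subset_rfl Set.subset_union_left
          · simpa [h] using hi j h)
      refine ⟨m, hED hm, T', fun j => ⟨?_, ?_, (hT' j).2.2⟩, hd⟩
      · refine subset_trans ?_ (hT' j).1
        by_cases h : j = i
        · subst h; simp
        · simp [h]
      · refine (hT' j).2.1.trans ?_
        by_cases h : j = i
        · subst h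
          simp only [Function.update_self]
          rintro x ((rfl | hx) | hx)
          exacts [Or.inr hw, Or.inl hx, Or.inr (hED hx)]
        · simpa [h] using Set.union_subset_union_right _ hED
  · push Not at hcase
    -- Here `E` misses two of the sets, both touched by `w`. So `w` is the branching vertex, and the
    -- third set absorbs `E` if it touches `E`.
    obtain ⟨p, -, hp⟩ := hcase 0
    obtain ⟨q, hqp, hq⟩ := hcase p
    obtain ⟨i, hi⟩ : ∃ i : Fin 3, ∀ j, j ≠ i → j = p ∨ j = q := by
      have : ∀ p q : Fin 3, q ≠ p → ∃ i : Fin 3, ∀ j, j ≠ i → j = p ∨ j = q := by decide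
      exact this p q hqp
    have hwj : ∀ j, j ≠ i → Γ.Touches {w} (T j) := by
      intro j hj
      rcases hi j hj with rfl | rfl
      exacts [hsees _ hp, hsees _ hq]
    by_cases hi' : Γ.Touches E (T i)
    · refine ⟨w, hw, Function.update T i (E ∪ T i), fun j => ?_, fun j k hjk => ?_⟩
      · by_cases h : j = i
        · subst h
          rw [Function.update_self]
          refine ⟨Set.subset_union_right, ?_, ?_, hi'.connected_union hE (hT j),
            hwE'.mono subset_rfl Set.subset_union_left⟩
          · exact Set.union_subset (hED.trans Set.subset_union_right) Set.subset_union_left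
          · rintro (h | h)
            exacts [hwE h, hwT j h]
        · rw [Function.update_of_ne h]
          exact ⟨subset_rfl, Set.subset_union_left, hwT j, hT j, hwj j h⟩
      · have hET : ∀ k, Disjoint E (T k) := fun k => ((hTD k).mono_right hED).symm
        by_cases h : j = i
        · subst h
          simpa [Function.update_of_ne hjk.symm, hET] using hTT j k hjk
        · by_cases h' : k = i
          · subst h'
            simpa [Function.update_of_ne hjk, (hET _).symm] using hTT j k hjk
          · simpa [h, h'] using hTT j k hjk
    · refine ⟨w, hw, T, fun j => ⟨subset_rfl, Set.subset_union_left, hwT j, hT j, ?_⟩, hTT⟩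
      by_cases h : j = i
      · exact h ▸ hsees i hi'
      · exact hwj j h

end Connectivity

/-! ### Instances, deletion of vertices and precolouring. -/

section Instances

variable {V : Type u} {C : Type v}

@[simp] theorem plus_adj_some_some (G : SimpleGraph V) (B : Set V) (x y : V) :
    (G.plus B).Adj (some x) (some y) ↔ G.Adj x y := Iff.rfl

@[simp] theorem plus_adj_none_some (G : SimpleGraph V) (B : Set V) (y : V) :
    (G.plus B).Adj none (some y) ↔ y ∈ B := Iff.rfl

@[simp] theorem plus_adj_some_none (G : SimpleGraph V) (B : Set V) (x : V) :
    (G.plus B).Adj (some x) none ↔ x ∈ B := Iff.rfl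

/-- A graph with a boundary `B` with respect to the `K₅`-minor-free graphs, a precoloured clique
`A` in the boundary, and lists of the sizes required in the main theorem. -/
structure BoundaryInstance (G : SimpleGraph V) (A B : Set V) (L : V → Set C) : Prop where
  subset : A ⊆ B
  clique : G.IsClique A
  free : completeMinorFree 5 (G.plus B)
  one : ∀ x ∈ A, (L x).encard = 1
  ne : ∀ x ∈ A, ∀ y ∈ A, x ≠ y → L x ≠ L y
  three : ∀ x ∈ B, x ∉ A → 3 ≤ (L x).encard
  five : ∀ x ∉ B, 5 ≤ (L x).encard

/-- All instances on fewer than `n` vertices are colourable. -/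
def ColourableBelow (C : Type v) (n : ℕ) : Prop :=
  ∀ ⦃V : Type u⦄ [Finite V] (G : SimpleGraph V) (A B : Set V) (L : V → Set C),
    Nat.card V < n → BoundaryInstance G A B L → G.ListColourable L

/-- Colouring a graph `G'` on a proper subset `S` of the vertices of `G`, where `G'` with its
boundary is presented as a minor of `G.plus B`. -/
theorem ColourableBelow.exists_colouring_on [Finite V]
    (ih : ColourableBelow.{u} C (Nat.card V)) [Nonempty C]
    {G : SimpleGraph V} {B : Set V} (hfree : completeMinorFree 5 (G.plus B))
    (S : Set V) (hS : ∃ z, z ∉ S) (G' : SimpleGraph V) (A' B' : Set V) (L' : V → Set C)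
    (hAB : A' ⊆ B') (hA : G'.IsClique A')
    (P₀ : Set (Option V)) (T : V → Set (Option V))
    (hP₀ : ((G.plus B).induce P₀).Connected)
    (hT : ∀ x ∈ S, ((G.plus B).induce (T x)).Connected)
    (hPT : ∀ x ∈ S, Disjoint P₀ (T x))
    (hTT : ∀ x ∈ S, ∀ y ∈ S, x ≠ y → Disjoint (T x) (T y))
    (hadj₀ : ∀ x ∈ S, x ∈ B' → (G.plus B).Touches P₀ (T x))
    (hadj : ∀ x ∈ S, ∀ y ∈ S, G'.Adj x y → (G.plus B).Touches (T x) (T y))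
    (hone : ∀ x ∈ A', (L' x).encard = 1)
    (hne : ∀ x ∈ A', ∀ y ∈ A', x ≠ y → L' x ≠ L' y)
    (hthree : ∀ x ∈ S, x ∈ B' → x ∉ A' → 3 ≤ (L' x).encard)
    (hfive : ∀ x ∈ S, x ∉ B' → 5 ≤ (L' x).encard) :
    ∃ c : V → C, (∀ x ∈ S, c x ∈ L' x) ∧ ∀ x ∈ S, ∀ y ∈ S, G'.Adj x y → c x ≠ c y := by
  classical
  have hcard : Nat.card S < Nat.card V := by
    obtain ⟨z, hz⟩ := hS
    exact Set.ncard_lt_card fun h => hz (h ▸ Set.mem_univ z)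
  have hinst : BoundaryInstance (G'.induce S) (Subtype.val ⁻¹' A') (Subtype.val ⁻¹' B')
      (fun x : S => L' x.1) := by
    refine ⟨fun x hx => hAB hx, fun x hx y hy hxy => hA hx hy fun h => hxy (Subtype.ext h), ?_,
      fun x hx => hone _ hx, fun x hx y hy hxy => hne _ hx _ hy fun h => hxy (Subtype.ext h),
      fun x hx hx' => hthree _ x.2 hx hx', fun x hx => hfive _ x.2 hx⟩
    intro hminor
    refine hfree (hminor.trans_model (fun o => o.elim P₀ fun x => T x.1) ?_ ?_ ?_)
    · rintro (_ | x)
      exacts [hP₀, hT _ x.2]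
    · rintro (_ | x) (_ | y) hxy
      · exact absurd rfl hxy
      · exact hPT _ y.2
      · exact (hPT _ x.2).symm
      · exact hTT _ x.2 _ y.2 fun h => hxy (congrArg some (Subtype.ext h))
    · rintro (_ | x) (_ | y) hxy
      · exact hxy.elim
      · exact hadj₀ _ y.2 hxy
      · exact (hadj₀ _ x.2 hxy).symm
      · exact hadj _ x.2 _ y.2 hxy
  obtain ⟨c, hc⟩ := ih _ _ _ _ hcard hinst
  -- The colours off `S` are irrelevant.
  refine ⟨fun x => if h : x ∈ S then c ⟨x, h⟩ else Classical.arbitrary C, ?_, ?_⟩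
  · intro x hx
    simpa [hx] using hc ⟨x, hx⟩
  · intro x hx y hy hxy
    simp only [hx, hy, dif_pos]
    exact c.valid (v := ⟨x, hx⟩) (w := ⟨y, hy⟩) hxy

/-- Colouring `G` without the vertex `z`, where the branch set of the added vertex lies in
`{none, some z}`. -/
theorem ColourableBelow.exists_colouring_ne [Finite V]
    (ih : ColourableBelow.{u} C (Nat.card V)) [Nonempty C]
    {G : SimpleGraph V} {B : Set V} (hfree : completeMinorFree 5 (G.plus B)) (z : V)
    (A' B' : Set V) (L' : V → Set C) (hAB : A' ⊆ B') (hA : G.IsClique A')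
    (P₀ : Set (Option V)) (hP₀ : ((G.plus B).induce P₀).Connected) (hP₀z : P₀ ⊆ {none, some z})
    (hadj₀ : ∀ x ≠ z, x ∈ B' → (G.plus B).Touches P₀ {some x})
    (hone : ∀ x ∈ A', (L' x).encard = 1)
    (hne : ∀ x ∈ A', ∀ y ∈ A', x ≠ y → L' x ≠ L' y)
    (hthree : ∀ x ≠ z, x ∈ B' → x ∉ A' → 3 ≤ (L' x).encard)
    (hfive : ∀ x ≠ z, x ∉ B' → 5 ≤ (L' x).encard) :
    ∃ c : V → C, (∀ x ≠ z, c x ∈ L' x) ∧ ∀ x ≠ z, ∀ y ≠ z, G.Adj x y → c x ≠ c y := by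
  refine ih.exists_colouring_on hfree {x | x ≠ z} ⟨z, fun h => h rfl⟩ G A' B' L' hAB hA P₀ (fun x => {some x}) hP₀
    (fun x _ => connected_induce_singleton _ _) ?_ ?_ hadj₀ ?_ hone hne hthree hfive
  · intro x hx
    rw [Set.disjoint_singleton_right]
    intro h
    rcases hP₀z h with h | h
    · cases h
    · exact hx (Option.some.inj h)
  · intro x _ y _ hxy
    simpa using hxy
  · intro x _ y _ hxy
    exact ⟨_, rfl, _, rfl, hxy⟩

/-- Extending a colouring of `G` without `z` to `z`. -/
theorem listColourable_of_exists_ne {G : SimpleGraph V} {L : V → Set C} {z : V} {c : V → C}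
    (hc : ∀ x ≠ z, c x ∈ L x) (hcc : ∀ x ≠ z, ∀ y ≠ z, G.Adj x y → c x ≠ c y)
    {α : C} (hα : α ∈ L z) (hαc : ∀ x, G.Adj z x → c x ≠ α) : G.ListColourable L := by
  classical
  refine ⟨Coloring.mk (Function.update c z α) ?_, ?_⟩
  · intro x y hxy
    by_cases hx : x = z
    · subst hx
      rw [Function.update_self, Function.update_of_ne hxy.ne']
      exact (hαc y hxy).symm
    · by_cases hy : y = z
      · subst hy
        rw [Function.update_self, Function.update_of_ne hxy.ne]
        exact hαc x hxy.symm
      · rw [Function.update_of_ne hx, Function.update_of_ne hy]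
        exact hcc x hx y hy hxy
  · intro x
    change Function.update c z α x ∈ L x
    by_cases hx : x = z
    · subst hx
      simpa using hα
    · simpa [hx] using hc x hx

theorem le_encard_diff {s t : Set C} {a b : ℕ} (hs : ((a + b : ℕ) : ℕ∞) ≤ s.encard)
    (ht : t.encard ≤ b) : (a : ℕ∞) ≤ (s \ t).encard := by
  have h1 : s.encard ≤ (s \ t).encard + t.encard :=
    (Set.encard_le_encard (by simp)).trans (Set.encard_union_le (s \ t) t)
  have h2 : ((a + b : ℕ) : ℕ∞) ≤ (s \ t).encard + b := hs.trans (h1.trans (by gcongr))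
  push_cast at h2
  exact (ENat.add_le_add_iff_right (ENat.natCast_ne_top b)).mp h2

theorem connected_pair_plus {G : SimpleGraph V} {B : Set V} {z : V} (hz : z ∈ B) :
    ((G.plus B).induce {none, some z}).Connected :=
  induce_pair_connected_of_adj (by simpa using hz)

variable {G : SimpleGraph V} {A B : Set V} {L : V → Set C}

namespace BoundaryInstance

theorem exists_mem (I : BoundaryInstance G A B L) (x : V) : (L x).Nonempty := by
  rw [← Set.one_le_encard_iff_nonempty]
  by_cases hB : x ∈ B
  · by_cases hA : x ∈ A
    · exact (I.one x hA).ge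
    · exact le_trans (by norm_num) (I.three x hB hA)
  · exact le_trans (by norm_num) (I.five x hB)

/-- A precoloured vertex all of whose neighbours in the boundary are precoloured can be deleted. -/
theorem colourable_of_mem [Finite V] (I : BoundaryInstance G A B L)
    (ih : ColourableBelow.{u} C (Nat.card V)) {a : V} (ha : a ∈ A)
    (hnb : ∀ x, G.Adj a x → x ∈ B → x ∈ A) : G.ListColourable L := by
  classical
  obtain ⟨α, hα⟩ := Set.encard_eq_one.mp (I.one a ha)
  have : Nonempty C := ⟨α⟩
  have hLA : ∀ x ∈ A, x ≠ a → L x \ {α} = L x := by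
    intro x hx hxa
    obtain ⟨β, hβ⟩ := Set.encard_eq_one.mp (I.one x hx)
    have := I.ne x hx a ha hxa
    rw [hβ, hα] at this
    rw [hβ, sdiff_eq_left, Set.disjoint_singleton]
    exact fun h => this (h ▸ rfl)
  -- Contracting `a` into the added vertex puts all neighbours of `a` into the boundary. Those new
  -- to it can lose the colour of `a` and still keep three colours.
  obtain ⟨c, hc, hcc⟩ := ih.exists_colouring_ne I.free a (A \ {a}) {x | x ∈ B ∨ G.Adj a x}
    (fun x => if G.Adj a x then L x \ {α} else L x) (fun x hx => Or.inl (I.subset hx.1))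
    (I.clique.subset Set.sdiff_subset) {none, some a}
    (connected_pair_plus (I.subset ha)) subset_rfl
    (fun x _ hx => by
      rcases hx with hx | hx
      · exact ⟨none, Or.inl rfl, _, rfl, hx⟩
      · exact ⟨some a, Or.inr rfl, _, rfl, hx⟩)
    (fun x hx => by
      rw [hLA x hx.1 hx.2, ite_self]
      exact I.one x hx.1)
    (fun x hx y hy hxy => by
      rw [hLA x hx.1 hx.2, hLA y hy.1 hy.2, ite_self, ite_self]
      exact I.ne x hx.1 y hy.1 hxy)
    (fun x hxa hx hxA => by
      have hxA' : x ∉ A := fun h => hxA ⟨h, hxa⟩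
      by_cases hax : G.Adj a x
      · have hxB : x ∉ B := fun h => hxA' (hnb x hax h)
        rw [if_pos hax]
        refine le_encard_diff (a := 3) (b := 2) (I.five x hxB) ?_
        rw [Set.encard_singleton]
        norm_num
      · rw [if_neg hax]
        exact I.three x (hx.resolve_right hax) hxA')
    (fun x _ hx => by
      have hax : ¬ G.Adj a x := fun h => hx (Or.inr h)
      rw [if_neg hax]
      exact I.five x fun h => hx (Or.inl h))
  refine listColourable_of_exists_ne (z := a) (c := c) (α := α) (fun x hx => ?_) hcc
    (hα ▸ rfl) fun x hax => ?_
  · have := hc x hx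
    by_cases hax : G.Adj a x
    · rw [if_pos hax] at this
      exact this.1
    · rwa [if_neg hax] at this
  · have := hc x hax.ne'
    rw [if_pos hax] at this
    exact this.2

/-- An instance with empty boundary reduces to a smaller one. -/
theorem colourable_of_boundary_empty [Finite V] [Nonempty V] (I : BoundaryInstance G ∅ ∅ L)
    (ih : ColourableBelow.{u} C (Nat.card V)) : G.ListColourable L := by
  classical
  obtain ⟨z⟩ := ‹Nonempty V›
  obtain ⟨α, hα⟩ := I.exists_mem z
  have : Nonempty C := ⟨α⟩
  -- With no boundary, `z` itself plays the added vertex of the smaller instance.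
  obtain ⟨c, hc, hcc⟩ := ih.exists_colouring_ne I.free z ∅ {x | G.Adj z x}
    (fun x => if G.Adj z x then L x \ {α} else L x) (by simp) (by simp) {some z}
    (connected_induce_singleton _ _) (by simp)
    (fun x _ hx => ⟨some z, rfl, _, rfl, hx⟩) (by simp) (by simp)
    (fun x _ hx _ => by
      rw [if_pos (show G.Adj z x from hx)]
      refine le_encard_diff (a := 3) (b := 2) (I.five x (by simp)) ?_
      rw [Set.encard_singleton]
      norm_num)
    (fun x _ hx => by
      rw [if_neg (show ¬ G.Adj z x from hx)]
      exact I.five x (by simp))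
  refine listColourable_of_exists_ne (z := z) (c := c) (α := α) (fun x hx => ?_) hcc
    hα fun x hzx => ?_
  · have := hc x hx
    by_cases hzx : G.Adj z x
    · rw [if_pos hzx] at this
      exact this.1
    · rwa [if_neg hzx] at this
  · have := hc x hzx.ne'
    rw [if_pos hzx] at this
    exact this.2

/-- A boundary vertex with at most one precoloured neighbour and at most one other neighbour in
the boundary can be deleted. -/
theorem colourable_of_few_neighbours [Finite V] (I : BoundaryInstance G A B L)
    (ih : ColourableBelow.{u} C (Nat.card V)) {z : V} (hzB : z ∈ B) (hzA : z ∉ A)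
    (hnA : ∀ x ∈ A, ∀ y ∈ A, G.Adj z x → G.Adj z y → x = y)
    (hnB : ∀ x ∈ B \ A, ∀ y ∈ B \ A, G.Adj z x → G.Adj z y → x = y) :
    G.ListColourable L := by
  classical
  obtain ⟨α₀, hα₀⟩ := I.exists_mem z
  have : Nonempty C := ⟨α₀⟩
  -- `α` is the only colour forced on a neighbour of `z` by precolouring; any colour will do if
  -- there is no such neighbour.
  obtain ⟨α, hα⟩ : ∃ α : C, ∀ x ∈ A, G.Adj z x → L x = {α} := by
    by_cases h : ∃ x ∈ A, G.Adj z x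
    · obtain ⟨x, hx, hzx⟩ := h
      obtain ⟨α, hα⟩ := Set.encard_eq_one.mp (I.one x hx)
      exact ⟨α, fun y hy hzy => hnA x hx y hy hzx hzy ▸ hα⟩
    · exact ⟨α₀, fun x hx hzx => (h ⟨x, hx, hzx⟩).elim⟩
  have h2 : (1 : ℕ∞) < (L z \ {α}).encard := by
    refine lt_of_lt_of_le (by norm_num) (le_encard_diff (a := 2) (b := 1) (I.three z hzB hzA) ?_)
    rw [Set.encard_singleton]
    norm_num
  obtain ⟨s, t, hs, ht, hst⟩ := Set.one_lt_encard_iff.mp h2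
  -- The colours `s`, `t` are reserved for `z`: neighbours outside `B` give them up, going from five
  -- colours to three as they enter the boundary. The one possible neighbour in `B \ A` can block
  -- only one of them.
  obtain ⟨c, hc, hcc⟩ := ih.exists_colouring_ne I.free z A {x | x ∈ B ∨ G.Adj z x}
    (fun x => if G.Adj z x ∧ x ∉ B then L x \ {s, t} else L x) (fun x hx => Or.inl (I.subset hx))
    I.clique {none, some z} (connected_pair_plus hzB) subset_rfl
    (fun x _ hx => by
      rcases hx with hx | hx
      · exact ⟨none, Or.inl rfl, _, rfl, hx⟩
      · exact ⟨some z, Or.inr rfl, _, rfl, hx⟩)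
    (fun x hx => by
      rw [if_neg fun h => h.2 (I.subset hx)]
      exact I.one x hx)
    (fun x hx y hy hxy => by
      rw [if_neg fun h => h.2 (I.subset hx), if_neg fun h => h.2 (I.subset hy)]
      exact I.ne x hx y hy hxy)
    (fun x _ hx hxA => by
      by_cases hxB : x ∈ B
      · rw [if_neg fun h => h.2 hxB]
        exact I.three x hxB hxA
      · rw [if_pos ⟨hx.resolve_left hxB, hxB⟩]
        exact le_encard_diff (a := 3) (b := 2) (I.five x hxB) (Set.encard_pair hst).le)
    (fun x _ hx => by
      rw [if_neg fun h => hx (Or.inr h.1)]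
      exact I.five x fun h => hx (Or.inl h))
  have hcL : ∀ x ≠ z, c x ∈ L x := fun x hx => by
    have := hc x hx
    by_cases hzx : G.Adj z x ∧ x ∉ B
    · rw [if_pos hzx] at this
      exact this.1
    · rwa [if_neg hzx] at this
  obtain ⟨γ, hγ, hγst, hγc⟩ : ∃ γ ∈ L z \ {α}, (γ = s ∨ γ = t) ∧
      ∀ x ∈ B \ A, G.Adj z x → c x ≠ γ := by
    by_cases h : ∃ x ∈ B \ A, G.Adj z x ∧ c x = s
    · obtain ⟨x, hx, hzx, hxs⟩ := h
      refine ⟨t, ht, Or.inr rfl, fun y hy hzy hyt => hst ?_⟩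
      rw [← hxs, ← hyt, hnB x hx y hy hzx hzy]
    · exact ⟨s, hs, Or.inl rfl, fun x hx hzx hxs => h ⟨x, hx, hzx, hxs⟩⟩
  refine listColourable_of_exists_ne hcL hcc hγ.1 fun x hzx hxγ => ?_
  by_cases hxB : x ∈ B
  · by_cases hxA : x ∈ A
    · have := hcL x hzx.ne'
      rw [hα x hxA hzx, hxγ] at this
      exact hγ.2 this
    · exact hγc x ⟨hxB, hxA⟩ hzx hxγ
  · have := hc x hzx.ne'
    rw [if_pos ⟨hzx, hxB⟩, hxγ] at this
    exact this.2 hγst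

/-- A boundary vertex adjacent to all of at most two precoloured vertices can be precoloured. -/
theorem exists_insert (I : BoundaryInstance G A B L) {z : V} (hzB : z ∈ B) (hzA : z ∉ A)
    (hcard : A.encard ≤ 2) (hadj : ∀ x ∈ A, G.Adj z x) :
    ∃ L' : V → Set C, (∀ x, L' x ⊆ L x) ∧ BoundaryInstance G (insert z A) B L' := by
  classical
  -- Otherwise the at least three colours of `z` would inject into the at most two vertices of `A`.
  obtain ⟨α, hαz, hα⟩ : ∃ α ∈ L z, ∀ x ∈ A, L x ≠ {α} := by
    by_contra! h
    have : Nonempty V := ⟨z⟩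
    choose! f hf hf' using h
    have hinj : Set.InjOn f (L z) := by
      intro α hα β hβ h
      have := hf' α hα
      rw [h, hf' β hβ] at this
      exact (Set.singleton_injective this).symm
    have h1 := hinj.encard_image
    have h2 : (f '' L z).encard ≤ 2 := (Set.encard_le_encard (by
      rintro _ ⟨α, hα, rfl⟩
      exact hf α hα)).trans hcard
    have h3 := (I.three z hzB hzA).trans (h1 ▸ h2)
    exact absurd h3 (by norm_num)
  have hup : ∀ x ∈ A, Function.update L z {α} x = L x := fun x hx =>
    Function.update_of_ne (ne_of_mem_of_not_mem hx hzA) _ _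
  refine ⟨Function.update L z {α}, fun x => ?_, ?_⟩
  · by_cases hx : x = z
    · subst hx
      simpa using hαz
    · rw [Function.update_of_ne hx]
  · refine ⟨Set.insert_subset hzB I.subset, ?_, I.free, ?_, ?_, ?_, ?_⟩
    · exact I.clique.insert fun x hx _ => hadj x hx
    · rintro x (rfl | hx)
      · simp
      · rw [hup x hx]
        exact I.one x hx
    · rintro x (rfl | hx) y (rfl | hy) hxy
      · exact absurd rfl hxy
      · rw [hup y hy, Function.update_self]
        exact (hα y hy).symm
      · rw [hup x hx, Function.update_self]
        exact hα x hx
      · rw [hup x hx, hup y hy]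
        exact I.ne x hx y hy hxy
    · intro x hx hxA
      rw [Function.update_of_ne fun h => hxA (Or.inl h)]
      exact I.three x hx fun h => hxA (Or.inr h)
    · intro x hx
      rw [Function.update_of_ne (ne_of_mem_of_not_mem hzB hx).symm]
      exact I.five x hx

end BoundaryInstance

theorem ListColourable.mono {L' : V → Set C} (h : G.ListColourable L') (hL : ∀ x, L' x ⊆ L x) :
    G.ListColourable L := by
  obtain ⟨c, hc⟩ := h
  exact ⟨c, fun x => hL x (hc x)⟩

end Instances

/-! ### Separations of order at most two. -/

section Separations

variable {V : Type u} {C : Type v} {G : SimpleGraph V} {A B : Set V} {L : V → Set C}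

/-- Disjoint connected sets `P₀` and `T x`, for `x ∈ S`, of `G.plus B`, the first one containing
the added vertex and each `T x` containing `x`. -/
structure IsModelOn (G : SimpleGraph V) (B S : Set V) (P₀ : Set (Option V))
    (T : V → Set (Option V)) : Prop where
  none_mem : none ∈ P₀
  mem : ∀ x ∈ S, some x ∈ T x
  connected_none : ((G.plus B).induce P₀).Connected
  connected : ∀ x ∈ S, ((G.plus B).induce (T x)).Connected
  disjoint_none : ∀ x ∈ S, Disjoint P₀ (T x)
  disjoint : ∀ x ∈ S, ∀ y ∈ S, x ≠ y → Disjoint (T x) (T y)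

theorem isModelOn_singleton {S : Set V} {P₀ : Set (Option V)} (h : none ∈ P₀)
    (hP₀ : ((G.plus B).induce P₀).Connected) (hS : ∀ x ∈ S, some x ∉ P₀) :
    IsModelOn G B S P₀ (fun x => {some x}) where
  none_mem := h
  mem _ _ := rfl
  connected_none := hP₀
  connected _ _ := connected_induce_singleton _ _
  disjoint_none x hx := by simpa using hS x hx
  disjoint x _ y _ hxy := by simpa using hxy

/-- Three pairwise disjoint connected sets of `G.plus B`, containing the added vertex, `y₁` and
`y₂`, respectively, and otherwise contained in `K`. -/
structure IsRootedTriple (G : SimpleGraph V) (B K : Set V) (y₁ y₂ : V)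
    (P₀ P₁ P₂ : Set (Option V)) : Prop where
  mem₀ : none ∈ P₀
  mem₁ : some y₁ ∈ P₁
  mem₂ : some y₂ ∈ P₂
  connected₀ : ((G.plus B).induce P₀).Connected
  connected₁ : ((G.plus B).induce P₁).Connected
  connected₂ : ((G.plus B).induce P₂).Connected
  disjoint₀₁ : Disjoint P₀ P₁
  disjoint₀₂ : Disjoint P₀ P₂
  disjoint₁₂ : Disjoint P₁ P₂
  subset : ∀ x, some x ∈ P₀ ∪ P₁ ∪ P₂ → x = y₁ ∨ x = y₂ ∨ x ∈ K

open Classical in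
theorem IsRootedTriple.isModelOn {K S : Set V} {y₁ y₂ : V} {P₀ P₁ P₂ : Set (Option V)}
    (h : IsRootedTriple G B K y₁ y₂ P₀ P₁ P₂) (hKS : Disjoint K S) :
    IsModelOn G B S P₀ (fun x => if x = y₁ then P₁ else if x = y₂ then P₂ else {some x}) := by
  have hne : y₁ ≠ y₂ := by
    rintro rfl
    exact Set.disjoint_left.mp h.disjoint₁₂ h.mem₁ h.mem₂
  have hout : ∀ x ∈ S, x ≠ y₁ → x ≠ y₂ → some x ∉ P₀ ∪ P₁ ∪ P₂ := by
    intro x hx h1 h2 hxP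
    rcases h.subset x hxP with h' | h' | h'
    exacts [h1 h', h2 h', Set.disjoint_left.mp hKS h' hx]
  simp only [Set.mem_union, not_or] at hout
  refine ⟨h.mem₀, ?_, h.connected₀, ?_, ?_, ?_⟩
  · intro x hx
    split_ifs with h1 h2
    exacts [h1 ▸ h.mem₁, h2 ▸ h.mem₂, rfl]
  · intro x hx
    by_cases h1 : x = y₁
    · rw [if_pos h1]
      exact h.connected₁
    · by_cases h2 : x = y₂
      · rw [if_neg h1, if_pos h2]
        exact h.connected₂
      · rw [if_neg h1, if_neg h2]
        exact connected_induce_singleton _ _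
  · intro x hx
    split_ifs with h1 h2
    · exact h.disjoint₀₁
    · exact h.disjoint₀₂
    · rw [Set.disjoint_singleton_right]
      exact (hout x hx h1 h2).1.1
  · intro x hx y hy hxy
    split_ifs with h1 h2 h3 h4 h5 h6 h7 h8
    · exact absurd (h1.trans h2.symm) hxy
    · exact h.disjoint₁₂
    · rw [Set.disjoint_singleton_right]
      exact (hout y hy h2 h3).1.2
    · exact h.disjoint₁₂.symm
    · exact absurd (h4.trans h6.symm) hxy
    · rw [Set.disjoint_singleton_right]
      exact (hout y hy h5 h6).2
    · rw [Set.disjoint_singleton_left]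
      exact (hout x hx h1 h4).1.2
    · rw [Set.disjoint_singleton_left]
      exact (hout x hx h1 h4).2
    · simpa using hxy

/-- Colouring first one side of a separation and then the other side, with the vertices of the
separator precoloured. -/
theorem BoundaryInstance.colourable_of_models [Finite V] (I : BoundaryInstance G A B L)
    (ih : ColourableBelow.{u} C (Nat.card V)) {D₁ D₂ Y : Set V}
    (hcover : ∀ x, x ∈ D₁ ∨ x ∈ Y ∨ x ∈ D₂) (hD₁ : D₁.Nonempty) (hD₂ : D₂.Nonempty)
    (hd₁ : Disjoint D₁ Y) (hd₂ : Disjoint D₂ Y) (hd : Disjoint D₁ D₂)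
    (hno : ∀ x ∈ D₁, ∀ y ∈ D₂, ¬ G.Adj x y) (hA : ∀ x ∈ A, x ∈ D₁ ∨ x ∈ Y)
    {P₀ Q₀ : Set (Option V)} {T T' : V → Set (Option V)}
    (hT : IsModelOn G B (D₁ ∪ Y) P₀ T) (hT' : IsModelOn G B (D₂ ∪ Y) Q₀ T')
    (hTY : ∀ x ∈ Y, ∀ y ∈ Y, x ≠ y → (G.plus B).Touches (T x) (T y))
    (hTY' : ∀ x ∈ Y, ∀ y ∈ Y, x ≠ y → (G.plus B).Touches (T' x) (T' y))
    (hQY : ∀ x ∈ Y, (G.plus B).Touches Q₀ (T' x)) : G.ListColourable L := by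
  classical
  have hC : Nonempty C := by
    obtain ⟨x, hx⟩ := hD₁
    exact ⟨(I.exists_mem x).some⟩
  -- Completing `Y` to a clique makes the first colouring give it distinct colours, as needed for
  -- `Y` to be the precoloured clique of the second instance.
  let G' : SimpleGraph V := G ⊔ fromRel fun x y => x ∈ Y ∧ y ∈ Y
  have hGG' : ∀ {x y}, G.Adj x y → G'.Adj x y := fun h => Or.inl h
  have hYG' : ∀ {x y}, x ∈ Y → y ∈ Y → x ≠ y → G'.Adj x y := fun hx hy hxy =>
    Or.inr ⟨hxy, Or.inl ⟨hx, hy⟩⟩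
  have hG'cases : ∀ {x y}, G'.Adj x y → G.Adj x y ∨ (x ∈ Y ∧ y ∈ Y ∧ x ≠ y) := by
    rintro x y (h | ⟨hxy, h | h⟩)
    exacts [Or.inl h, Or.inr ⟨h.1, h.2, hxy⟩, Or.inr ⟨h.2, h.1, hxy⟩]
  obtain ⟨z₁, hz₁⟩ := hD₁
  obtain ⟨z₂, hz₂⟩ := hD₂
  obtain ⟨c₁, hc₁, hcc₁⟩ := ih.exists_colouring_on I.free (D₁ ∪ Y)
    ⟨z₂, fun h => h.elim (fun h => Set.disjoint_left.mp hd h hz₂)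
      fun h => Set.disjoint_left.mp hd₂ hz₂ h⟩ G' A B L I.subset
    (fun x hx y hy hxy => hGG' (I.clique hx hy hxy)) P₀ T hT.connected_none hT.connected
    hT.disjoint_none hT.disjoint
    (fun x hx hxB => ⟨none, hT.none_mem, some x, hT.mem x hx, hxB⟩)
    (fun x hx y hy hxy => by
      rcases hG'cases hxy with h | ⟨h, h', hne⟩
      · exact ⟨some x, hT.mem x hx, some y, hT.mem y hy, h⟩
      · exact hTY x h y h' hne)
    I.one I.ne (fun x _ => I.three x) (fun x _ => I.five x)
  -- Now all of `Y` has to lie in the boundary, which is why `Q₀` must touch the branch sets of `Y`.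
  obtain ⟨c₂, hc₂, hcc₂⟩ := ih.exists_colouring_on I.free (D₂ ∪ Y)
    ⟨z₁, fun h => h.elim (fun h => Set.disjoint_left.mp hd hz₁ h)
      fun h => Set.disjoint_left.mp hd₁ hz₁ h⟩ G' Y (B ∪ Y)
    (fun x => if x ∈ Y then {c₁ x} else L x) Set.subset_union_right
    (fun x hx y hy hxy => hYG' hx hy hxy) Q₀ T' hT'.connected_none hT'.connected
    hT'.disjoint_none hT'.disjoint
    (fun x hx hxB => by
      rcases hxB with h | h
      · exact ⟨none, hT'.none_mem, some x, hT'.mem x hx, h⟩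
      · exact hQY x h)
    (fun x hx y hy hxy => by
      rcases hG'cases hxy with h | ⟨h, h', hne⟩
      · exact ⟨some x, hT'.mem x hx, some y, hT'.mem y hy, h⟩
      · exact hTY' x h y h' hne)
    (fun x hx => by
      rw [if_pos hx]
      exact Set.encard_singleton _)
    (fun x hx y hy hxy h => by
      rw [if_pos hx, if_pos hy] at h
      exact hcc₁ x (Or.inr hx) y (Or.inr hy) (hYG' hx hy hxy) (Set.singleton_injective h))
    (fun x hx hxB hxY => by
      rw [if_neg hxY]
      refine I.three x (hxB.resolve_right hxY) fun hxA => ?_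
      exact Set.disjoint_left.mp hd ((hA x hxA).resolve_right hxY) (hx.resolve_right hxY))
    (fun x _ hx => by
      rw [if_neg fun h => hx (Or.inr h)]
      exact I.five x fun h => hx (Or.inl h))
  have hY : ∀ x ∈ Y, c₂ x = c₁ x := fun x hx => by
    have := hc₂ x (Or.inr hx)
    rwa [if_pos hx] at this
  set c : V → C := fun x => if x ∈ D₁ ∪ Y then c₁ x else c₂ x with hcdef
  have hcS₁ : ∀ x ∈ D₁ ∪ Y, c x = c₁ x := fun x hx => if_pos hx
  have hcS₂ : ∀ x ∈ D₂ ∪ Y, c x = c₂ x := fun x hx => by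
    by_cases hxY : x ∈ Y
    · rw [hcS₁ x (Or.inr hxY), hY x hxY]
    · refine if_neg fun h => ?_
      exact Set.disjoint_left.mp hd (h.resolve_right hxY) (hx.resolve_right hxY)
  refine ⟨Coloring.mk c ?_, ?_⟩
  · intro x y hxy
    rcases hcover x with hx | hx | hx
    · rcases hcover y with hy | hy | hy
      · rw [hcS₁ x (Or.inl hx), hcS₁ y (Or.inl hy)]
        exact hcc₁ x (Or.inl hx) y (Or.inl hy) (hGG' hxy)
      · rw [hcS₁ x (Or.inl hx), hcS₁ y (Or.inr hy)]
        exact hcc₁ x (Or.inl hx) y (Or.inr hy) (hGG' hxy)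
      · exact absurd hxy (hno x hx y hy)
    · rcases hcover y with hy | hy | hy
      · rw [hcS₁ x (Or.inr hx), hcS₁ y (Or.inl hy)]
        exact hcc₁ x (Or.inr hx) y (Or.inl hy) (hGG' hxy)
      · rw [hcS₁ x (Or.inr hx), hcS₁ y (Or.inr hy)]
        exact hcc₁ x (Or.inr hx) y (Or.inr hy) (hGG' hxy)
      · rw [hcS₂ x (Or.inr hx), hcS₂ y (Or.inl hy)]
        exact hcc₂ x (Or.inr hx) y (Or.inl hy) (hGG' hxy)
    · rcases hcover y with hy | hy | hy
      · exact absurd hxy.symm (hno y hy x hx)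
      · rw [hcS₂ x (Or.inl hx), hcS₂ y (Or.inr hy)]
        exact hcc₂ x (Or.inl hx) y (Or.inr hy) (hGG' hxy)
      · rw [hcS₂ x (Or.inl hx), hcS₂ y (Or.inl hy)]
        exact hcc₂ x (Or.inl hx) y (Or.inl hy) (hGG' hxy)
  · intro x
    change c x ∈ L x
    by_cases hx : x ∈ D₁ ∪ Y
    · rw [hcS₁ x hx]
      exact hc₁ x hx
    · have hxY : x ∉ Y := fun h => hx (Or.inr h)
      have hx₂ : x ∈ D₂ ∪ Y := Or.inl
        (((hcover x).resolve_left fun h => hx (Or.inl h)).resolve_left hxY)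
      have := hc₂ x hx₂
      rw [if_neg hxY] at this
      rwa [hcS₂ x hx₂]

/-- `Y` separates the nonempty set `D` from some other vertex. -/
structure Separates (G : SimpleGraph V) (D Y : Set V) : Prop where
  nonempty : D.Nonempty
  disjoint : Disjoint D Y
  mem_or_mem : ∀ x ∈ D, ∀ y, G.Adj x y → y ∈ D ∨ y ∈ Y
  exists_not_mem : ∃ z, z ∉ D ∧ z ∉ Y

theorem Separates.compl {D Y : Set V} (h : Separates G D Y) : Separates G (D ∪ Y)ᶜ Y where
  nonempty := by
    obtain ⟨z, hz⟩ := h.exists_not_mem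
    exact ⟨z, by simpa using hz⟩
  disjoint := Set.disjoint_left.mpr fun x hx hxY => hx (Or.inr hxY)
  mem_or_mem := by
    intro x hx y hxy
    by_contra hcon
    simp only [Set.mem_compl_iff, Set.mem_union, not_or, not_and, not_not] at hcon hx
    rcases h.mem_or_mem y (by tauto) x hxy.symm with h | h
    exacts [hx.1 h, hx.2 h]
  exists_not_mem := by
    obtain ⟨x, hx⟩ := h.nonempty
    exact ⟨x, fun h' => h' (Or.inl hx), Set.disjoint_left.mp h.disjoint hx⟩

/-- If `y` had no neighbour in `K`, the rest of `Y` would already separate `K`, from `y` among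
others. -/
theorem Separates.adj_of_component {D Y K : Set V} (h : Separates G D Y) (hKD : K ⊆ D)
    (hK : K.Nonempty) (hcl : ∀ x ∈ K, ∀ y ∈ D, G.Adj x y → y ∈ K) {y : V} (hy : y ∈ Y)
    (hno : ¬ Separates G K (Y \ {y})) : ∃ x ∈ K, G.Adj x y := by
  by_contra! hcon
  refine hno ⟨hK, (h.disjoint.mono_left hKD).mono_right Set.sdiff_subset, ?_, y, ?_, ?_⟩
  · intro x hx z hxz
    rcases h.mem_or_mem x (hKD hx) z hxz with hz | hz
    · exact Or.inl (hcl x hx z hz hxz)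
    · refine Or.inr ⟨hz, ?_⟩
      rintro rfl
      exact hcon x hx hxz
  · exact fun hyK => Set.disjoint_left.mp h.disjoint (hKD hyK) hy
  · exact fun h' => h'.2 rfl

theorem connected_image_some {K : Set V} (hK : (G.induce K).Connected) (B : Set V) :
    ((G.plus B).induce (some '' K)).Connected := by
  refine hK.map (⟨fun x => ⟨some x.1, x.1, x.2, rfl⟩, fun h => h⟩ :
    G.induce K →g (G.plus B).induce (some '' K)) ?_
  rintro ⟨_, x, hx, rfl⟩
  exact ⟨⟨x, hx⟩, rfl⟩

theorem touches_image_some {K : Set V} {y : V} (h : ∃ x ∈ K, G.Adj x y) (B : Set V) :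
    (G.plus B).Touches (some '' K) {some y} := by
  obtain ⟨x, hx, hxy⟩ := h
  exact ⟨some x, ⟨x, hx, rfl⟩, some y, rfl, hxy⟩

/-- One side of a separation of order at most two contains the precoloured clique, and this side
or the separator itself meets the boundary suitably. -/
theorem BoundaryInstance.exists_side (I : BoundaryInstance G A B L) (hAne : A.Nonempty)
    (hnb : ∀ a ∈ A, ∃ x ∈ B \ A, G.Adj a x) {D : Set V} {y₁ y₂ : V}
    (h : Separates G D {y₁, y₂}) :
    ∃ D', Separates G D' {y₁, y₂} ∧ (∀ x ∈ A, x ∈ D' ∨ x ∈ ({y₁, y₂} : Set V)) ∧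
      ((∃ b ∈ B, b ∈ D') ∨ {y₁, y₂} ⊆ B) := by
  -- A clique cannot meet both sides of a separation.
  have key : ∀ D', Separates G D' {y₁, y₂} → (∃ a ∈ A, a ∈ D') →
      ∃ D', Separates G D' {y₁, y₂} ∧ (∀ x ∈ A, x ∈ D' ∨ x ∈ ({y₁, y₂} : Set V)) ∧
      ((∃ b ∈ B, b ∈ D') ∨ {y₁, y₂} ⊆ B) := by
    rintro D' h' ⟨a, ha, haD⟩
    refine ⟨D', h', fun x hx => ?_, Or.inl ⟨a, I.subset ha, haD⟩⟩
    by_cases hax : a = x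
    · exact Or.inl (hax ▸ haD)
    · exact h'.mem_or_mem a haD x (I.clique ha hx hax)
  by_cases h₁ : ∃ a ∈ A, a ∈ D
  · exact key D h h₁
  by_cases h₂ : ∃ a ∈ A, a ∈ (D ∪ {y₁, y₂})ᶜ
  · exact key _ h.compl h₂
  push Not at h₁ h₂
  -- With `A` inside the separator, a neighbour `b ∈ B \ A` of some `a ∈ A` decides: either `b` lies
  -- in a side, which is chosen, or `{a, b}` is the whole separator.
  have hAY : ∀ x ∈ A, x ∈ ({y₁, y₂} : Set V) := fun x hx =>
    (Set.notMem_compl_iff.mp (h₂ x hx)).resolve_left (h₁ x hx)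
  obtain ⟨a, ha⟩ := hAne
  obtain ⟨b, hb, hab⟩ := hnb a ha
  by_cases hbY : b ∈ ({y₁, y₂} : Set V)
  · refine ⟨D, h, fun x hx => Or.inr (hAY x hx), Or.inr ?_⟩
    have haB := I.subset ha
    have hbB := hb.1
    have hne := hab.ne
    rcases hAY a ha with rfl | h1 <;> rcases hbY with rfl | h2
    · exact absurd rfl hne
    · rcases h2
      rintro x (rfl | rfl) <;> assumption
    · rcases h1
      rintro x (rfl | rfl) <;> assumption
    · exact absurd (h1.trans h2.symm) hne
  · by_cases hbD : b ∈ D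
    · exact ⟨D, h, fun x hx => Or.inr (hAY x hx), Or.inl ⟨b, hb.1, hbD⟩⟩
    · refine ⟨_, h.compl, fun x hx => Or.inr (hAY x hx), Or.inl ⟨b, hb.1, ?_⟩⟩
      rintro (h' | h')
      exacts [hbD h', hbY h']

theorem BoundaryInstance.colourable_of_separates_empty [Finite V] (I : BoundaryInstance G A B L)
    (ih : ColourableBelow.{u} C (Nat.card V)) {D : Set V} (h : Separates G D ∅) :
    G.ListColourable L := by
  have key : ∀ D', Separates G D' ∅ → (∀ x ∈ A, x ∈ D') → G.ListColourable L := by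
    intro D' h' hA
    refine I.colourable_of_models ih (D₁ := D') (D₂ := D'ᶜ) (Y := ∅) (P₀ := {none})
      (Q₀ := {none}) (T := fun x => {some x}) (T' := fun x => {some x}) ?_ h'.nonempty ?_
      (by simp) (by simp) disjoint_compl_right ?_ (fun x hx => Or.inl (hA x hx))
      ?_ ?_ (by simp) (by simp) (by simp)
    · intro x
      by_cases hx : x ∈ D' <;> simp [hx]
    · simpa using h'.compl.nonempty
    · intro x hx y hy hxy
      rcases h'.mem_or_mem x hx y hxy with h | h
      exacts [hy h, h]
    · exact isModelOn_singleton rfl (connected_induce_singleton _ _) (by simp)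
    · exact isModelOn_singleton rfl (connected_induce_singleton _ _) (by simp)
  by_cases hA : ∃ a ∈ A, a ∈ D
  · obtain ⟨a, ha, haD⟩ := hA
    refine key D h fun x hx => ?_
    by_cases hax : a = x
    · exact hax ▸ haD
    · exact (h.mem_or_mem a haD x (I.clique ha hx hax)).resolve_right (by simp)
  · push Not at hA
    exact key _ h.compl fun x hx => by simpa using hA x hx

theorem BoundaryInstance.colourable_of_separates_singleton [Finite V]
    (I : BoundaryInstance G A B L) (ih : ColourableBelow.{u} C (Nat.card V)) (hAne : A.Nonempty)
    (hnb : ∀ a ∈ A, ∃ x ∈ B \ A, G.Adj a x) (h₀ : ∀ D, ¬ Separates G D ∅)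
    {D : Set V} {y : V} (h : Separates G D {y}) : G.ListColourable L := by
  obtain ⟨D, h, hA, hB⟩ := I.exists_side hAne hnb (y₁ := y) (y₂ := y) (by simpa using h)
  rw [Set.pair_eq_singleton] at h hA hB
  -- If `y` is not itself in `B`, the added vertex reaches it through a component of `D` that meets
  -- `B`.
  obtain ⟨Q₀, hQ, hQc, hQS, hQy⟩ : ∃ Q₀ : Set (Option V), none ∈ Q₀ ∧
      ((G.plus B).induce Q₀).Connected ∧ (∀ x ∈ (D ∪ {y})ᶜ ∪ {y}, some x ∉ Q₀) ∧
      (G.plus B).Touches Q₀ {some y} := by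
    rcases hB with ⟨b, hb, hbD⟩ | hyB
    · obtain ⟨K, hKD, hbK, hK, hcl⟩ := exists_component G hbD
      have hKy := h.adj_of_component hKD ⟨b, hbK⟩ hcl rfl (by simpa using h₀ K)
      refine ⟨{none} ∪ some '' K, Or.inl rfl, ?_, ?_, ?_⟩
      · refine Touches.connected_union ?_ (connected_induce_singleton _ _)
          (connected_image_some hK B)
        exact ⟨none, rfl, some b, ⟨b, hbK, rfl⟩, hb⟩
      · rintro x hx (h' | ⟨z, hz, hzx⟩)
        · cases h'
        · obtain rfl := Option.some.inj hzx
          rcases hx with hx | hx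
          · exact hx (Or.inl (hKD hz))
          · exact Set.disjoint_left.mp h.disjoint (hKD hz) hx
      · exact (touches_image_some hKy B).mono Set.subset_union_right subset_rfl
    · exact ⟨{none}, rfl, connected_induce_singleton _ _, by simp, none, rfl, _, rfl, hyB rfl⟩
  refine I.colourable_of_models ih (D₁ := D) (D₂ := (D ∪ {y})ᶜ) (Y := {y}) (P₀ := {none})
    (Q₀ := Q₀) (T := fun x => {some x}) (T' := fun x => {some x}) ?_ h.nonempty h.compl.nonempty
    h.disjoint h.compl.disjoint ?_ ?_ hA
    (isModelOn_singleton rfl (connected_induce_singleton _ _) (by simp))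
    (isModelOn_singleton hQ hQc hQS) ?_ ?_ ?_
  · intro x
    simp only [Set.mem_compl_iff, Set.mem_union]
    tauto
  · exact Set.disjoint_left.mpr fun x hx hx' => hx' (Or.inl hx)
  · intro x hx z hz hxz
    exact hz (h.mem_or_mem x hx z hxz)
  · rintro x rfl z rfl hxz
    exact absurd rfl hxz
  · rintro x rfl z rfl hxz
    exact absurd rfl hxz
  · rintro x rfl
    exact hQy

/-- In a graph without cut vertices, a component `K` behind a separator `{y₁, y₂}` outside the
boundary that contains two boundary vertices contains a triangle rooted at the separator and the
added vertex. -/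
theorem exists_rootedTriple_of_two_mem [Finite V] (h₁ : ∀ D y, ¬ Separates G D {y})
    {K : Set V} {y₁ y₂ a b : V} (hK : (G.induce K).Connected)
    (hcl : ∀ x ∈ K, ∀ y, G.Adj x y → y ∈ K ∨ y = y₁ ∨ y = y₂)
    (hy₁K : y₁ ∉ K) (hy₂K : y₂ ∉ K) (hy : y₁ ≠ y₂)
    (hKy₁ : ∃ x ∈ K, G.Adj x y₁) (hKy₂ : ∃ x ∈ K, G.Adj x y₂)
    (ha : a ∈ K) (hb : b ∈ K) (haB : a ∈ B) (hbB : b ∈ B) (hab : a ≠ b) :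
    ∃ P₀ P₁ P₂, IsRootedTriple G B K y₁ y₂ P₀ P₁ P₂ ∧ (G.plus B).Touches P₀ P₁ ∧
      (G.plus B).Touches P₀ P₂ ∧ (G.plus B).Touches P₁ P₂ := by
  -- This yields a tripod with centre `m` and feet at the added vertex, `y₁` and `y₂`. A triangle
  -- arises once the leg of the added vertex, enlarged to a component `U` of what the other two legs
  -- and `m` leave, touches another leg: `m` then joins the remaining leg.
  obtain ⟨m', ⟨m, hm, rfl⟩, T, hT, hTd⟩ := exists_branching_vertex (Γ := G.plus B) _ (some '' K)
    ![{none}, {some y₁}, {some y₂}] rfl (connected_image_some hK B)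
    (by
      intro i
      fin_cases i <;> exact connected_induce_singleton _ _)
    (by
      intro i j hij
      fin_cases i <;> fin_cases j <;> first | exact absurd rfl hij | simp [hy, hy.symm])
    (by
      intro i
      fin_cases i <;> simp [hy₁K, hy₂K])
    (by
      intro i
      fin_cases i
      · exact ⟨some a, ⟨a, ha, rfl⟩, none, rfl, haB⟩
      · exact touches_image_some hKy₁ B
      · exact touches_image_some hKy₂ B)
  obtain ⟨hs0, hT0, hm0, hc0, ht0⟩ := hT 0
  obtain ⟨hs1, hT1, hm1, hc1, ht1⟩ := hT 1
  obtain ⟨hs2, hT2, hm2, hc2, ht2⟩ := hT 2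
  have hd01 := hTd 0 1 (by decide)
  have hd02 := hTd 0 2 (by decide)
  have hd12 := hTd 1 2 (by decide)
  generalize T 0 = T₀ at *
  generalize T 1 = T₁ at *
  generalize T 2 = T₂ at *
  replace hs0 : none ∈ T₀ := hs0 rfl
  replace hs1 : some y₁ ∈ T₁ := hs1 rfl
  replace hs2 : some y₂ ∈ T₂ := hs2 rfl
  replace hT0 : T₀ ⊆ {none} ∪ some '' K := hT0
  replace hT1 : T₁ ⊆ {some y₁} ∪ some '' K := hT1
  replace hT2 : T₂ ⊆ {some y₂} ∪ some '' K := hT2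
  have hF : T₀ ⊆ ({none} ∪ some '' K) \ ({some m} ∪ T₁ ∪ T₂) := by
    intro x hx
    refine ⟨hT0 hx, ?_⟩
    rintro ((rfl | h) | h)
    exacts [hm0 hx, Set.disjoint_left.mp hd01 hx h, Set.disjoint_left.mp hd02 hx h]
  obtain ⟨U, hUF, hU, hUc, hUcl⟩ := exists_component (G.plus B) (hF hs0)
  have hT0U : T₀ ⊆ U := by
    intro x hx
    by_contra hxU
    obtain ⟨p, hp, hpU, q, hq, hqU, hpq⟩ :=
      exists_adj_of_connected_induce hc0 hs0 hU hx hxU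
    exact hqU (hUcl p hpU q (hF hq) hpq)
  have hmU : some m ∉ U := fun h => (hUF h).2 (Or.inl (Or.inl rfl))
  have hUd1 : Disjoint U T₁ := Set.disjoint_left.mpr fun x hx h => (hUF hx).2 (Or.inl (Or.inr h))
  have hUd2 : Disjoint U T₂ := Set.disjoint_left.mpr fun x hx h => (hUF hx).2 (Or.inr h)
  have hUm : (G.plus B).Touches U {some m} := (ht0.mono subset_rfl hT0U).symm
  have hsub : ∀ x, some x ∈ U ∪ T₁ ∪ T₂ ∪ {some m} → x = y₁ ∨ x = y₂ ∨ x ∈ K := by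
    rintro x (((h | h) | h) | h)
    · rcases (hUF h).1 with h' | ⟨z, hz, hzx⟩
      · cases h'
      · exact Or.inr (Or.inr (Option.some.inj hzx ▸ hz))
    · rcases hT1 h with h' | ⟨z, hz, hzx⟩
      · exact Or.inl (Option.some.inj h')
      · exact Or.inr (Or.inr (Option.some.inj hzx ▸ hz))
    · rcases hT2 h with h' | ⟨z, hz, hzx⟩
      · exact Or.inr (Or.inl (Option.some.inj h'))
      · exact Or.inr (Or.inr (Option.some.inj hzx ▸ hz))
    · exact Or.inr (Or.inr (Option.some.inj h ▸ hm))
  by_cases hU1 : (G.plus B).Touches U T₁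
  · refine ⟨U, T₁, {some m} ∪ T₂, ⟨hU, hs1, Or.inr hs2, hUc, hc1,
      ht2.connected_union (connected_induce_singleton _ _) hc2, hUd1, ?_, ?_, ?_⟩, hU1,
      hUm.mono subset_rfl Set.subset_union_left,
      ht1.symm.mono subset_rfl Set.subset_union_left⟩
    · rw [Set.disjoint_union_right, Set.disjoint_singleton_right]
      exact ⟨hmU, hUd2⟩
    · rw [Set.disjoint_union_right, Set.disjoint_singleton_right]
      exact ⟨hm1, hd12⟩
    · intro x hx
      apply hsub
      simp only [Set.mem_union] at hx ⊢
      tauto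
  by_cases hU2 : (G.plus B).Touches U T₂
  · refine ⟨U, {some m} ∪ T₁, T₂, ⟨hU, Or.inr hs1, hs2, hUc,
      ht1.connected_union (connected_induce_singleton _ _) hc1, hc2, ?_, hUd2, ?_, ?_⟩,
      hUm.mono subset_rfl Set.subset_union_left, hU2,
      ht2.mono Set.subset_union_left subset_rfl⟩
    · rw [Set.disjoint_union_right, Set.disjoint_singleton_right]
      exact ⟨hmU, hUd1⟩
    · rw [Set.disjoint_union_left, Set.disjoint_singleton_left]
      exact ⟨hm2, hd12⟩
    · intro x hx
      apply hsub
      simp only [Set.mem_union] at hx ⊢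
      tauto
  -- If `U` touches neither leg, its vertices in `K` have neighbours outside `U` only at `m`. There
  -- are such vertices, as `K` has a boundary vertex other than `m`; so `m` is a cut vertex.
  exfalso
  obtain ⟨d, hd, hdB, hdm⟩ : ∃ d ∈ K, d ∈ B ∧ d ≠ m := by
    by_cases ham : a = m
    · exact ⟨b, hb, hbB, fun h => hab (ham.trans h.symm)⟩
    · exact ⟨a, ha, haB, ham⟩
  have hstep : ∀ p ∈ U, ∀ x, x ∈ K → x ≠ m → (G.plus B).Adj p (some x) → some x ∈ U := by
    intro p hp x hx hxm hpx
    refine hUcl p hp _ ⟨Or.inr ⟨x, hx, rfl⟩, ?_⟩ hpx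
    rintro ((h | h) | h)
    exacts [hxm (Option.some.inj h), hU1 ⟨p, hp, _, h, hpx⟩, hU2 ⟨p, hp, _, h, hpx⟩]
  have hUK : ∀ x, some x ∈ U → x ∈ K := by
    intro x hx
    rcases (hUF hx).1 with h' | ⟨z, hz, hzx⟩
    · cases h'
    · exact Option.some.inj hzx ▸ hz
  refine h₁ {x | some x ∈ U} m ⟨⟨d, hstep none hU d hd hdm hdB⟩, ?_, ?_, y₁, ?_, ?_⟩
  · simpa using hmU
  · intro x hx y hxy
    by_cases hym : y = m
    · exact Or.inr hym
    · rcases hcl x (hUK x hx) y hxy with h | rfl | rfl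
      · exact Or.inl (hstep _ hx y h hym hxy)
      · exact (hU1 ⟨_, hx, _, hs1, hxy⟩).elim
      · exact (hU2 ⟨_, hx, _, hs2, hxy⟩).elim
  · exact fun h => hy₁K (hUK _ h)
  · rintro rfl
    exact hy₁K hm

theorem isRootedTriple_left {K : Set V} {y₁ y₂ : V} (hK : (G.induce K).Connected)
    (hy₂K : y₂ ∉ K) (hy : y₁ ≠ y₂) (hKy₁ : ∃ x ∈ K, G.Adj x y₁) :
    IsRootedTriple G B K y₁ y₂ {none} (some '' K ∪ {some y₁}) {some y₂} where
  mem₀ := rfl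
  mem₁ := Or.inr rfl
  mem₂ := rfl
  connected₀ := connected_induce_singleton _ _
  connected₁ := (touches_image_some hKy₁ B).connected_union (connected_image_some hK B)
    (connected_induce_singleton _ _)
  connected₂ := connected_induce_singleton _ _
  disjoint₀₁ := by simp
  disjoint₀₂ := by simp
  disjoint₁₂ := by simp [hy₂K, hy.symm]
  subset := by
    intro x hx
    simp only [Set.mem_union, Set.mem_singleton_iff, Set.mem_image, Option.some.injEq,
      exists_eq_right, reduceCtorEq, false_or] at hx
    tauto

theorem isRootedTriple_right {K : Set V} {y₁ y₂ : V} (hK : (G.induce K).Connected)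
    (hy₁K : y₁ ∉ K) (hy : y₁ ≠ y₂) (hKy₂ : ∃ x ∈ K, G.Adj x y₂) :
    IsRootedTriple G B K y₁ y₂ {none} {some y₁} (some '' K ∪ {some y₂}) :=
  have h := isRootedTriple_left (B := B) hK hy₁K hy.symm hKy₂
  ⟨h.mem₀, h.mem₂, h.mem₁, h.connected₀, h.connected₂, h.connected₁, h.disjoint₀₂, h.disjoint₀₁,
    h.disjoint₁₂.symm, fun x hx => by
      have := h.subset x (by
        simp only [Set.mem_union] at hx ⊢
        tauto)
      tauto⟩

theorem BoundaryInstance.colourable_of_separates_pair [Finite V]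
    (I : BoundaryInstance G A B L) (ih : ColourableBelow.{u} C (Nat.card V)) (hAne : A.Nonempty)
    (hnb : ∀ a ∈ A, ∃ x ∈ B \ A, G.Adj a x) (h₁ : ∀ D y, ¬ Separates G D {y})
    {D : Set V} {y₁ y₂ : V} (hy : y₁ ≠ y₂) (h : Separates G D {y₁, y₂}) :
    G.ListColourable L := by
  classical
  obtain ⟨D, h, hA, hB⟩ := I.exists_side hAne hnb h
  have hdiff₁ : ({y₁, y₂} : Set V) \ {y₁} = {y₂} := by
    ext x
    simp only [Set.mem_sdiff, Set.mem_insert_iff, Set.mem_singleton_iff]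
    grind
  have hdiff₂ : ({y₁, y₂} : Set V) \ {y₂} = {y₁} := by
    ext x
    simp only [Set.mem_sdiff, Set.mem_insert_iff, Set.mem_singleton_iff]
    grind
  have hcomp : ∀ {D'}, Separates G D' {y₁, y₂} → ∀ {b}, b ∈ D' → ∃ K ⊆ D', b ∈ K ∧
      (G.induce K).Connected ∧ (∀ x ∈ K, ∀ y, G.Adj x y → y ∈ K ∨ y = y₁ ∨ y = y₂) ∧
      y₁ ∉ K ∧ y₂ ∉ K ∧ (∃ x ∈ K, G.Adj x y₁) ∧ ∃ x ∈ K, G.Adj x y₂ := by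
    intro D' h' b hb
    obtain ⟨K, hKD, hbK, hK, hcl⟩ := exists_component G hb
    refine ⟨K, hKD, hbK, hK, fun x hx y hxy => ?_,
      fun hyK => Set.disjoint_left.mp h'.disjoint (hKD hyK) (Or.inl rfl),
      fun hyK => Set.disjoint_left.mp h'.disjoint (hKD hyK) (Or.inr rfl),
      h'.adj_of_component hKD ⟨b, hbK⟩ hcl (Or.inl rfl) (by rw [hdiff₁]; exact h₁ K y₂),
      h'.adj_of_component hKD ⟨b, hbK⟩ hcl (Or.inr rfl) (by rw [hdiff₂]; exact h₁ K y₁)⟩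
    rcases h'.mem_or_mem x (hKD hx) y hxy with h | h
    · exact Or.inl (hcl x hx y h hxy)
    · exact Or.inr h
  -- The second instance needs a triangle on the added vertex and the separator. If some `yᵢ` is in
  -- `B`, contracting a component of `D` onto one separator vertex suffices. If not, a precoloured
  -- vertex and its neighbour in `B \ A` give two boundary vertices in one component.
  obtain ⟨Q₀, Q₁, Q₂, K, hKD, hQ, hQ01, hQ02, hQ12⟩ : ∃ Q₀ Q₁ Q₂, ∃ K ⊆ D,
      IsRootedTriple G B K y₁ y₂ Q₀ Q₁ Q₂ ∧ (G.plus B).Touches Q₀ Q₁ ∧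
      (G.plus B).Touches Q₀ Q₂ ∧ (G.plus B).Touches Q₁ Q₂ := by
    by_cases hYB : y₁ ∈ B ∧ y₂ ∈ B
    · obtain ⟨d, hd⟩ := h.nonempty
      obtain ⟨K, hKD, -, hK, -, hy₁K, hy₂K, hKy₁, hKy₂⟩ := hcomp h hd
      refine ⟨_, _, _, K, hKD, isRootedTriple_left hK hy₂K hy hKy₁,
        ⟨none, rfl, some y₁, Or.inr rfl, hYB.1⟩, ⟨none, rfl, some y₂, rfl, hYB.2⟩,
        (touches_image_some hKy₂ B).mono Set.subset_union_left subset_rfl⟩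
    obtain ⟨b, hbB, hbD⟩ := hB.resolve_right fun h => hYB ⟨h (Or.inl rfl), h (Or.inr rfl)⟩
    by_cases hy₂B : y₂ ∈ B
    · obtain ⟨K, hKD, hbK, hK, -, hy₁K, hy₂K, hKy₁, hKy₂⟩ := hcomp h hbD
      exact ⟨_, _, _, K, hKD, isRootedTriple_left hK hy₂K hy hKy₁,
        ⟨none, rfl, some b, Or.inl ⟨b, hbK, rfl⟩, hbB⟩, ⟨none, rfl, some y₂, rfl, hy₂B⟩,
        (touches_image_some hKy₂ B).mono Set.subset_union_left subset_rfl⟩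
    by_cases hy₁B : y₁ ∈ B
    · obtain ⟨K, hKD, hbK, hK, -, hy₁K, hy₂K, hKy₁, hKy₂⟩ := hcomp h hbD
      exact ⟨_, _, _, K, hKD, isRootedTriple_right hK hy₁K hy hKy₂,
        ⟨none, rfl, some y₁, rfl, hy₁B⟩, ⟨none, rfl, some b, Or.inl ⟨b, hbK, rfl⟩, hbB⟩,
        ((touches_image_some hKy₁ B).mono Set.subset_union_left subset_rfl).symm⟩
    obtain ⟨a, ha⟩ := hAne
    have haD : a ∈ D := by
      rcases hA a ha with h | rfl | h
      · exact h
      · exact absurd (I.subset ha) hy₁B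
      · rcases h
        exact absurd (I.subset ha) hy₂B
    obtain ⟨K, hKD, haK, hK, hcl, hy₁K, hy₂K, hKy₁, hKy₂⟩ := hcomp h haD
    obtain ⟨d, hd, had⟩ := hnb a ha
    have hdK : d ∈ K := by
      rcases hcl a haK d had with h | rfl | rfl
      exacts [h, absurd hd.1 hy₁B, absurd hd.1 hy₂B]
    obtain ⟨Q₀, Q₁, Q₂, hQ⟩ := exists_rootedTriple_of_two_mem h₁ hK hcl hy₁K hy₂K hy hKy₁ hKy₂
      haK hdK (I.subset ha) hd.1 had.ne
    exact ⟨Q₀, Q₁, Q₂, K, hKD, hQ⟩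
  obtain ⟨d, hd⟩ := h.compl.nonempty
  obtain ⟨K', hKD', -, hK', -, hy₁K', hy₂K', hKy₁', hKy₂'⟩ := hcomp h.compl hd
  -- The first instance keeps its boundary and needs only the edge `y₁y₂`, got by contracting a
  -- component of the other side onto `y₁`.
  have hP := isRootedTriple_left (B := B) hK' hy₂K' hy hKy₁'
  have hP12 : (G.plus B).Touches (some '' K' ∪ {some y₁}) {some y₂} :=
    (touches_image_some hKy₂' B).mono Set.subset_union_left subset_rfl
  refine I.colourable_of_models ih (D₁ := D) (D₂ := (D ∪ {y₁, y₂})ᶜ) (Y := {y₁, y₂})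
    ?_ h.nonempty h.compl.nonempty h.disjoint h.compl.disjoint ?_ ?_ hA
    (hP.isModelOn (S := D ∪ {y₁, y₂}) ?_) (hQ.isModelOn (S := (D ∪ {y₁, y₂})ᶜ ∪ {y₁, y₂}) ?_)
    ?_ ?_ ?_
  · intro x
    simp only [Set.mem_compl_iff, Set.mem_union]
    tauto
  · exact Set.disjoint_left.mpr fun x hx hx' => hx' (Or.inl hx)
  · intro x hx z hz hxz
    exact hz (h.mem_or_mem x hx z hxz)
  · exact Set.disjoint_left.mpr fun x hx hx' => hKD' hx hx'
  · refine Set.disjoint_left.mpr fun x hx hx' => ?_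
    rcases hx' with hx' | hx'
    · exact hx' (Or.inl (hKD hx))
    · exact Set.disjoint_left.mp h.disjoint (hKD hx) hx'
  · rintro x (rfl | rfl) z (rfl | rfl) hxz
    · exact absurd rfl hxz
    · simpa [hy.symm] using hP12
    · simpa [hy.symm] using hP12.symm
    · exact absurd rfl hxz
  · rintro x (rfl | rfl) z (rfl | rfl) hxz
    · exact absurd rfl hxz
    · simpa [hy.symm] using hQ12
    · simpa [hy.symm] using hQ12.symm
    · exact absurd rfl hxz
  · rintro x (rfl | rfl)
    · simpa using hQ01
    · simpa [hy.symm] using hQ02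

end Separations

/-! ### Cycles and rooted triangle minors. -/

section Cycles

variable {V : Type u} {C : Type v} {G : SimpleGraph V} {A B : Set V} {L : V → Set C}

theorem connected_induce_image_Icc {f : ℕ → V} (hf : ∀ i, G.Adj (f i) (f (i + 1))) (a : ℕ) :
    ∀ b, a ≤ b → (G.induce (f '' Set.Icc a b)).Connected := by
  intro b hab
  induction b, hab using Nat.le_induction with
  | base =>
    rw [Set.Icc_self, Set.image_singleton]
    exact connected_induce_singleton G (f a)
  | succ b hab ih =>
    have : f '' Set.Icc a (b + 1) = f '' Set.Icc a b ∪ {f (b + 1)} := by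
      rw [← Set.image_singleton, ← Set.image_union]
      congr 1
      ext i
      simp only [Set.mem_Icc, Set.mem_union, Set.mem_singleton_iff]
      omega
    rw [this]
    exact Touches.connected_union ⟨f b, ⟨b, ⟨hab, le_rfl⟩, rfl⟩, _, rfl, hf b⟩ ih
      (connected_induce_singleton _ _)

/-- In `Z`, any three vertices root a triangle minor. -/
def IsTriangleRooted (G : SimpleGraph V) (Z : Set V) : Prop :=
  ∀ z : Fin 3 → V, (∀ i, z i ∈ Z) → Function.Injective z →
    ∃ P : Fin 3 → Set V, (∀ i, z i ∈ P i ∧ P i ⊆ Z ∧ (G.induce (P i)).Connected) ∧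
      ∀ i j, i ≠ j → Disjoint (P i) (P j) ∧ G.Touches (P i) (P j)

theorem isTriangleRooted_of_clique {a b c : V} (hab : G.Adj a b) (hac : G.Adj a c)
    (hbc : G.Adj b c) : IsTriangleRooted G {a, b, c} := by
  intro z hz hinj
  have hadj : ∀ x ∈ ({a, b, c} : Set V), ∀ y ∈ ({a, b, c} : Set V), x ≠ y → G.Adj x y := by
    rintro x (rfl | rfl | rfl) y (rfl | rfl | rfl) hxy <;>
      first
      | exact absurd rfl hxy
      | assumption
      | (apply SimpleGraph.Adj.symm; assumption)
  refine ⟨fun i => {z i}, fun i => ⟨rfl, by simpa using hz i, connected_induce_singleton _ _⟩,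
    fun i j hij => ⟨by simpa using hinj.ne hij, _, rfl, _, rfl, hadj _ (hz i) _ (hz j) ?_⟩⟩
  exact hinj.ne hij

/-- Three vertices of a cycle, taken in order, cut it into three consecutive arcs, each ending at
one of them; the last arc also takes what remains up to the closing edge. -/
theorem isTriangleRooted_of_closed_walk {f : ℕ → V} (hf : ∀ i, G.Adj (f i) (f (i + 1)))
    {a d : ℕ} (hd : f a = f (a + d)) (hinj : Set.InjOn f (Set.Ico a (a + d))) :
    IsTriangleRooted G (f '' Set.Ico a (a + d)) := by
  have key : ∀ p : Fin 3 → ℕ, (∀ i, p i ∈ Set.Ico a (a + d)) → StrictMono p →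
      ∃ P : Fin 3 → Set V,
        (∀ i, f (p i) ∈ P i ∧ P i ⊆ f '' Set.Ico a (a + d) ∧ (G.induce (P i)).Connected) ∧
        ∀ i j, i ≠ j → Disjoint (P i) (P j) ∧ G.Touches (P i) (P j) := by
    intro p hp hmono
    have h01 : p 0 < p 1 := hmono (by decide)
    have h12 : p 1 < p 2 := hmono (by decide)
    have h0 := (hp 0).1
    have h2 := (hp 2).2
    have hd' : ∀ {s t u v : ℕ}, a ≤ s → v < a + d → t < u → s ≤ t → u ≤ v →
        Disjoint (f '' Set.Icc s t) (f '' Set.Icc u v) := by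
      intro s t u v h1 h2 h3 h4 h5
      rw [Set.disjoint_left]
      rintro _ ⟨x, hx, rfl⟩ ⟨y, hy, hxy⟩
      have hx1 := hx.1
      have hx2 := hx.2
      have hy1 := hy.1
      have hy2 := hy.2
      have := hinj ⟨by omega, by omega⟩ ⟨by omega, by omega⟩ hxy
      omega
    have hs : ∀ {s t : ℕ}, a ≤ s → t < a + d → f '' Set.Icc s t ⊆ f '' Set.Ico a (a + d) :=
      fun h h' => Set.image_mono fun x hx => ⟨h.trans hx.1, hx.2.trans_lt h'⟩
    have hd01 : Disjoint (f '' Set.Icc a (p 0)) (f '' Set.Icc (p 0 + 1) (p 1)) :=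
      hd' le_rfl (by omega) (by omega) h0 (by omega)
    have hd02 : Disjoint (f '' Set.Icc a (p 0)) (f '' Set.Icc (p 1 + 1) (a + d - 1)) :=
      hd' le_rfl (by omega) (by omega) h0 (by omega)
    have hd12 : Disjoint (f '' Set.Icc (p 0 + 1) (p 1)) (f '' Set.Icc (p 1 + 1) (a + d - 1)) :=
      hd' (by omega) (by omega) (by omega) (by omega) (by omega)
    have ht01 : G.Touches (f '' Set.Icc a (p 0)) (f '' Set.Icc (p 0 + 1) (p 1)) :=
      ⟨_, ⟨p 0, ⟨h0, le_rfl⟩, rfl⟩, _, ⟨p 0 + 1, ⟨le_rfl, h01⟩, rfl⟩, hf _⟩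
    have ht12 : G.Touches (f '' Set.Icc (p 0 + 1) (p 1)) (f '' Set.Icc (p 1 + 1) (a + d - 1)) :=
      ⟨_, ⟨p 1, ⟨h01, le_rfl⟩, rfl⟩, _, ⟨p 1 + 1, ⟨le_rfl, by omega⟩, rfl⟩, hf _⟩
    have ht20 : G.Touches (f '' Set.Icc (p 1 + 1) (a + d - 1)) (f '' Set.Icc a (p 0)) := by
      refine ⟨_, ⟨a + d - 1, ⟨by omega, le_rfl⟩, rfl⟩, _, ⟨a, ⟨le_rfl, h0⟩, rfl⟩, ?_⟩
      have := hf (a + d - 1)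
      rwa [show a + d - 1 + 1 = a + d by omega, ← hd] at this
    refine ⟨![f '' Set.Icc a (p 0), f '' Set.Icc (p 0 + 1) (p 1),
      f '' Set.Icc (p 1 + 1) (a + d - 1)], fun i => ?_, fun i j hij => ?_⟩
    · fin_cases i
      · exact ⟨⟨p 0, ⟨h0, le_rfl⟩, rfl⟩, hs le_rfl (by omega), connected_induce_image_Icc hf _ _ h0⟩
      · exact ⟨⟨p 1, ⟨h01, le_rfl⟩, rfl⟩, hs (by omega) (by omega),
          connected_induce_image_Icc hf _ _ h01⟩
      · exact ⟨⟨p 2, ⟨h12, by omega⟩, rfl⟩, hs (by omega) (by omega),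
          connected_induce_image_Icc hf _ _ (by omega)⟩
    · fin_cases i <;> fin_cases j
      · exact absurd rfl hij
      · exact ⟨hd01, ht01⟩
      · exact ⟨hd02, ht20.symm⟩
      · exact ⟨hd01.symm, ht01.symm⟩
      · exact absurd rfl hij
      · exact ⟨hd12, ht12⟩
      · exact ⟨hd02.symm, ht20⟩
      · exact ⟨hd12.symm, ht12.symm⟩
      · exact absurd rfl hij
  intro z hz hzinj
  choose p hp hpz using hz
  have hpinj : Function.Injective p := fun i j hij => hzinj (by rw [← hpz, ← hpz, hij])
  -- The roots come in any order, so their positions are sorted first and the arcs permuted back.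
  have hmono : StrictMono (p ∘ Tuple.sort p) :=
    (Tuple.monotone_sort p).strictMono_of_injective (hpinj.comp (Tuple.sort p).injective)
  obtain ⟨P, hP, hPP⟩ := key (p ∘ Tuple.sort p) (fun i => hp _) hmono
  refine ⟨fun i => P ((Tuple.sort p).symm i), fun i => ?_, fun i j hij => hPP _ _ ?_⟩
  · have := hP ((Tuple.sort p).symm i)
    simpa [hpz] using this
  · exact (Tuple.sort p).symm.injective.ne hij

/-- A nonempty finite set in which every vertex has two neighbours contains a cycle. -/
theorem exists_isTriangleRooted [Finite V] {F : Set V} (hF : F.Nonempty)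
    (h : ∀ x ∈ F, ∃ y ∈ F, ∃ z ∈ F, y ≠ z ∧ G.Adj x y ∧ G.Adj x z) :
    ∃ Z ⊆ F, 3 ≤ Z.ncard ∧ IsTriangleRooted G Z := by
  classical
  have hnext : ∀ x w : V, ∃ z, x ∈ F → z ∈ F ∧ G.Adj x z ∧ z ≠ w := by
    intro x w
    by_cases hx : x ∈ F
    · obtain ⟨y, hy, z, hz, hyz, hxy, hxz⟩ := h x hx
      by_cases hyw : y = w
      · exact ⟨z, fun _ => ⟨hz, hxz, fun h => hyz (hyw.trans h.symm)⟩⟩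
      · exact ⟨y, fun _ => ⟨hy, hxy, hyw⟩⟩
    · exact ⟨x, fun h => absurd h hx⟩
  choose nxt hnxt using hnext
  obtain ⟨x₀, hx₀⟩ := hF
  -- A walk in `F` that never turns straight back; the state is (previous, current). The fake
  -- predecessor `x₀` of the start excludes nothing, since `x₀` is not its own neighbour.
  let g : ℕ → V × V := fun n => (fun q : V × V => (q.2, nxt q.2 q.1))^[n] (x₀, x₀)
  have hg : ∀ n, g (n + 1) = ((g n).2, nxt (g n).2 (g n).1) := fun n =>
    Function.iterate_succ_apply' _ _ _
  set f : ℕ → V := fun n => (g n).2 with hfdef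
  have hfF : ∀ n, f n ∈ F := by
    intro n
    induction n with
    | zero => exact hx₀
    | succ n ih =>
      simp only [hfdef, hg]
      exact (hnxt _ _ ih).1
  have hf : ∀ n, G.Adj (f n) (f (n + 1)) := by
    intro n
    have := (hnxt (f n) (g n).1 (hfF n)).2.1
    simpa only [hfdef, hg] using this
  have hf2 : ∀ n, f (n + 2) ≠ f n := by
    intro n
    have := (hnxt (f (n + 1)) (g (n + 1)).1 (hfF (n + 1))).2.2
    simpa only [hfdef, hg] using this
  -- A repetition at the least distance `d` closes a cycle. Adjacency excludes `d = 1`, and not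
  -- turning back excludes `d = 2`.
  have hex : ∃ d, 0 < d ∧ ∃ a, f a = f (a + d) := by
    obtain ⟨i, j, hij, hfij⟩ := Finite.exists_ne_map_eq_of_infinite f
    rcases lt_or_gt_of_ne hij with hlt | hlt
    · exact ⟨j - i, by omega, i, by rw [hfij]; congr 1; omega⟩
    · exact ⟨i - j, by omega, j, by rw [← hfij]; congr 1; omega⟩
  obtain ⟨hd0, a, ha⟩ := Nat.find_spec hex
  have hmin : ∀ p q, p < q → q < p + Nat.find hex → f p ≠ f q := by
    intro p q hpq hqp hfpq
    exact Nat.find_min hex (m := q - p) (by omega)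
      ⟨by omega, p, by rw [hfpq]; congr 1; omega⟩
  generalize Nat.find hex = d at *
  have hinj : Set.InjOn f (Set.Ico a (a + d)) := by
    intro p hp q hq hpq
    by_contra hne
    have := hp.1; have := hp.2; have := hq.1; have := hq.2
    rcases lt_or_gt_of_ne hne with hlt | hlt
    · exact hmin p q hlt (by omega) hpq
    · exact hmin q p hlt (by omega) hpq.symm
  refine ⟨f '' Set.Ico a (a + d), ?_, ?_, isTriangleRooted_of_closed_walk hf ha hinj⟩
  · rintro _ ⟨i, -, rfl⟩
    exact hfF i
  · rw [hinj.ncard_image, ← Finset.coe_Ico, Set.ncard_coe_finset, Nat.card_Ico]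
    by_contra hlt
    obtain rfl | rfl : d = 1 ∨ d = 2 := by omega
    · exact (hf a).ne ha
    · exact hf2 a ha.symm

/-- A set of boundary vertices in which any three vertices root a triangle minor contains the
whole boundary if `G` has no small separators. -/
theorem subset_of_isTriangleRooted [Finite V] (hfree : completeMinorFree 5 (G.plus B))
    (hsep : ∀ D Y, Y.ncard ≤ 2 → ¬ Separates G D Y) {Z : Set V} (hZB : Z ⊆ B)
    (hZ : 3 ≤ Z.ncard) (hZT : IsTriangleRooted G Z) : B ⊆ Z := by
  intro b hb
  by_contra hbZ
  obtain ⟨Q, hQZ, hbQ, hQ, hcl⟩ := exists_component G (D := Zᶜ) hbZ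
  set N : Set V := {z | z ∈ Z ∧ ∃ x ∈ Q, G.Adj x z} with hN
  have hNZ : N ⊆ Z := fun z hz => hz.1
  -- Otherwise `N` would separate `Q` from a vertex of `Z \ N`, which exists because `Z` has at
  -- least three vertices.
  have hN3 : 2 < N.ncard := by
    by_contra! hle
    have hss : N ⊂ Z := hNZ.ssubset_of_ne fun h => by
      rw [h] at hle
      omega
    obtain ⟨z, hz, hzN⟩ := Set.exists_of_ssubset hss
    refine hsep Q N hle ⟨⟨b, hbQ⟩, ?_, ?_, z, fun h => hQZ h hz, hzN⟩
    · exact Set.disjoint_left.mpr fun x hx hxN => hQZ hx hxN.1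
    · intro x hx y hxy
      by_cases hy : y ∈ Z
      · exact Or.inr ⟨hy, x, hx, hxy⟩
      · exact Or.inl (hcl x hx y hy hxy)
  obtain ⟨p, hp, q, hq, r, hr, hpq, hpr, hqr⟩ := (Set.two_lt_ncard (Set.toFinite N)).mp hN3
  have hz : ∀ i, ![p, q, r] i ∈ N := by
    intro i
    fin_cases i <;> assumption
  obtain ⟨P, hP, hPP⟩ := hZT ![p, q, r] (fun i => (hz i).1) (by
    intro i j hij
    fin_cases i <;> fin_cases j <;> simp_all)
  have hPB : ∀ i, ∃ x ∈ P i, x ∈ B := fun i => ⟨_, (hP i).1, hZB (hz i).1⟩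
  have hQP : ∀ i, G.Touches Q (P i) := by
    intro i
    obtain ⟨x, hx, hxz⟩ := (hz i).2
    exact ⟨x, hx, _, (hP i).1, hxz⟩
  have himage : ∀ {s t : Set V}, G.Touches s t → (G.plus B).Touches (some '' s) (some '' t) := by
    rintro s t ⟨x, hx, y, hy, hxy⟩
    exact ⟨_, ⟨x, hx, rfl⟩, _, ⟨y, hy, rfl⟩, hxy⟩
  have hnone : ∀ {s : Set V}, (∃ x ∈ s, x ∈ B) → (G.plus B).Touches {none} (some '' s) := by
    rintro s ⟨x, hx, hxB⟩
    exact ⟨none, rfl, _, ⟨x, hx, rfl⟩, hxB⟩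
  have hdimage : ∀ {s t : Set V}, Disjoint s t → Disjoint (some '' s) (some '' t) := fun h =>
    Set.disjoint_image_of_injective (Option.some_injective V) h
  have hQPd : ∀ i, Disjoint Q (P i) := fun i =>
    Set.disjoint_left.mpr fun x hx hxP => hQZ hx ((hP i).2.1 hxP)
  have hndisj : ∀ s : Set V, Disjoint ({none} : Set (Option V)) (some '' s) := by simp
  -- The `K₅` model: the added vertex touches `Q` through `b` and each `P i` through its root, and
  -- `Q` touches each `P i` at its root.
  let M : Fin 5 → Set (Option V) := Fin.cons {none} (Fin.cons (some '' Q) fun i => some '' P i)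
  have hM : ∀ i j, i < j → Disjoint (M i) (M j) ∧ (G.plus B).Touches (M i) (M j) := by
    intro i j hij
    induction i using Fin.cases with
    | zero =>
      induction j using Fin.cases with
      | zero => exact absurd hij (lt_irrefl _)
      | succ j =>
        induction j using Fin.cases with
        | zero => exact ⟨hndisj _, hnone ⟨b, hbQ, hb⟩⟩
        | succ j => exact ⟨hndisj _, hnone (hPB j)⟩
    | succ i =>
      induction j using Fin.cases with
      | zero => exact absurd hij (Fin.not_lt_zero _)
      | succ j =>
        induction i using Fin.cases with
        | zero =>
          induction j using Fin.cases with
          | zero => exact absurd hij (lt_irrefl _)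
          | succ j => exact ⟨hdimage (hQPd j), himage (hQP j)⟩
        | succ i =>
          induction j using Fin.cases with
          | zero => exact absurd (Fin.succ_lt_succ_iff.mp hij) (Fin.not_lt_zero _)
          | succ j =>
            have hne : i ≠ j := fun h => lt_irrefl _ (h ▸ hij)
            exact ⟨hdimage (hPP i j hne).1, himage (hPP i j hne).2⟩
  refine hfree ⟨M, fun i => ?_, fun i j hij => ?_, fun i j hij => ?_⟩
  · induction i using Fin.cases with
    | zero => exact connected_induce_singleton _ _
    | succ i =>
      induction i using Fin.cases with
      | zero => exact connected_image_some hQ B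
      | succ i => exact connected_image_some (hP i).2.2 B
  · rcases lt_or_gt_of_ne hij with h | h
    exacts [(hM i j h).1, (hM j i h).1.symm]
  · rcases lt_or_gt_of_ne (show i ≠ j from hij.ne) with h | h
    exacts [(hM i j h).2, (hM j i h).2.symm]

end Cycles

/-! ### The minimal counterexample and the induction. -/

section Main

variable {V : Type u} {C : Type v} {G : SimpleGraph V} {A B : Set V} {L : V → Set C}

namespace BoundaryInstance

variable [Finite V]

/-- The case that at least two vertices are precoloured. -/
theorem colourable_of_two_mem (I : BoundaryInstance G A B L)
    (ih : ColourableBelow.{u} C (Nat.card V)) {a₁ a₂ : V} (ha₁ : a₁ ∈ A) (ha₂ : a₂ ∈ A)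
    (hne : a₁ ≠ a₂) : G.ListColourable L := by
  classical
  by_contra hcol
  have hnb : ∀ a ∈ A, ∃ x ∈ B \ A, G.Adj a x := by
    intro a ha
    by_contra! hcon
    exact hcol (I.colourable_of_mem ih ha fun x hax hxB =>
      by_contra fun hxA => hcon x ⟨hxB, hxA⟩ hax)
  have h₀ : ∀ D, ¬ Separates G D ∅ := fun D h => hcol (I.colourable_of_separates_empty ih h)
  have h₁ : ∀ D y, ¬ Separates G D {y} := fun D y h =>
    hcol (I.colourable_of_separates_singleton ih ⟨a₁, ha₁⟩ hnb h₀ h)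
  have hsep : ∀ D Y, Y.ncard ≤ 2 → ¬ Separates G D Y := by
    intro D Y hY h
    interval_cases hc : Y.ncard
    · rw [(Set.ncard_eq_zero (Set.toFinite Y)).mp hc] at h
      exact h₀ D h
    · obtain ⟨y, rfl⟩ := Set.ncard_eq_one.mp hc
      exact h₁ D y h
    · obtain ⟨y₁, y₂, hy, rfl⟩ := Set.ncard_eq_two.mp hc
      exact hcol (I.colourable_of_separates_pair ih ⟨a₁, ha₁⟩ hnb h₁ hy h)
  have ha₁₂ : G.Adj a₁ a₂ := I.clique ha₁ ha₂ hne
  have hcommon : ∀ z ∈ B, G.Adj z a₁ → ¬ G.Adj z a₂ := by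
    intro z hzB hz₁ hz₂
    have hBZ := subset_of_isTriangleRooted (Z := {a₁, a₂, z}) I.free hsep
      (by rintro x (rfl | rfl | rfl); exacts [I.subset ha₁, I.subset ha₂, hzB])
      (Set.ncard_eq_three.mpr ⟨a₁, a₂, z, hne, hz₁.ne', hz₂.ne', rfl⟩).ge
      (isTriangleRooted_of_clique ha₁₂ hz₁.symm hz₂.symm)
    have hBA : ∀ x ∈ B, x ∈ A ∨ x = z := by
      intro x hx
      rcases hBZ hx with rfl | rfl | rfl
      exacts [Or.inl ha₁, Or.inl ha₂, Or.inr rfl]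
    -- Since `B = {a₁, a₂, z}`, once `z` is precoloured the whole boundary is, and `a₁` can be
    -- deleted.
    by_cases hzA : z ∈ A
    · refine hcol (I.colourable_of_mem ih ha₁ fun x _ hxB => ?_)
      rcases hBA x hxB with h | rfl
      exacts [h, hzA]
    · have hAz : A ⊆ {a₁, a₂} := by
        intro x hx
        rcases hBZ (I.subset hx) with rfl | rfl | rfl
        exacts [Or.inl rfl, Or.inr rfl, absurd hx hzA]
      obtain ⟨L', hL', I'⟩ := I.exists_insert hzB hzA
        ((Set.encard_le_encard hAz).trans (Set.encard_pair hne).le) (fun x hx => by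
          rcases hAz hx with rfl | rfl
          exacts [hz₁, hz₂])
      refine hcol ((I'.colourable_of_mem ih (Or.inr ha₁) fun x _ hxB => ?_).mono hL')
      exact (hBA x hxB).symm
  have hA : ∀ x ∈ A, x = a₁ ∨ x = a₂ := by
    intro x hx
    by_contra! hcon
    exact hcommon x (I.subset hx) (I.clique hx ha₁ hcon.1) (I.clique hx ha₂ hcon.2)
  have hdeg : ∀ z ∈ B \ A, ∃ x ∈ B \ A, ∃ y ∈ B \ A, x ≠ y ∧ G.Adj z x ∧ G.Adj z y := by
    intro z hz
    by_contra! hcon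
    refine hcol (I.colourable_of_few_neighbours ih hz.1 hz.2 ?_ ?_)
    · intro x hx y hy hzx hzy
      rcases hA x hx with rfl | rfl <;> rcases hA y hy with rfl | rfl
      · rfl
      · exact absurd hzy (hcommon z hz.1 hzx)
      · exact absurd hzx (hcommon z hz.1 hzy)
      · rfl
    · intro x hx y hy hzx hzy
      by_contra hxy
      exact hcon x hx y hy hxy hzx hzy
  obtain ⟨x, hx, -⟩ := hnb a₁ ha₁
  obtain ⟨Z, hZ, hZ3, hZT⟩ := exists_isTriangleRooted ⟨x, hx⟩ hdeg
  exact (hZ (subset_of_isTriangleRooted I.free hsep (hZ.trans Set.sdiff_subset) hZ3 hZT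
    (I.subset ha₁))).2 ha₁

/-- A lone precoloured vertex either has a boundary neighbour, which can be precoloured as well, or
can be deleted. -/
theorem colourable_of_nonempty (I : BoundaryInstance G A B L)
    (ih : ColourableBelow.{u} C (Nat.card V)) (hA : A.Nonempty) : G.ListColourable L := by
  obtain ⟨a, ha⟩ := hA
  by_cases hA₂ : ∃ b ∈ A, b ≠ a
  · obtain ⟨b, hb, hba⟩ := hA₂
    exact I.colourable_of_two_mem ih hb ha hba
  push Not at hA₂
  by_cases hnb : ∃ x ∈ B, x ∉ A ∧ G.Adj a x
  · obtain ⟨x, hxB, hxA, hax⟩ := hnb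
    have hsub : A ⊆ {a} := fun y hy => hA₂ y hy
    obtain ⟨L', hL', I'⟩ := I.exists_insert hxB hxA
      ((Set.encard_le_encard hsub).trans (by rw [Set.encard_singleton]; norm_num))
      (fun y hy => hA₂ y hy ▸ hax.symm)
    exact (I'.colourable_of_two_mem ih (Or.inr ha) (Or.inl rfl) hax.ne).mono hL'
  · push Not at hnb
    exact I.colourable_of_mem ih ha fun x hax hxB =>
      by_contra fun hxA => hnb x hxB hxA hax

theorem colourable (I : BoundaryInstance G A B L)
    (ih : ColourableBelow.{u} C (Nat.card V)) : G.ListColourable L := by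
  rcases A.eq_empty_or_nonempty with rfl | hA
  · rcases B.eq_empty_or_nonempty with rfl | ⟨x, hx⟩
    · cases isEmpty_or_nonempty V
      · exact ⟨Coloring.mk (fun x => isEmptyElim x) fun {x} => isEmptyElim x,
          fun x => isEmptyElim x⟩
      · exact I.colourable_of_boundary_empty ih
    · obtain ⟨L', hL', I'⟩ := I.exists_insert hx (by simp) (by simp) (by simp)
      exact (I'.colourable_of_nonempty ih ⟨x, Or.inl rfl⟩).mono hL'
  · exact I.colourable_of_nonempty ih hA

end BoundaryInstance

theorem colourableBelow (C : Type v) (n : ℕ) : ColourableBelow.{u} C n := by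
  induction n with
  | zero => exact fun V _ G A B L h => absurd h (Nat.not_lt_zero _)
  | succ n ih =>
    intro V _ G A B L h I
    refine I.colourable fun W _ G' A' B' L' h' I' => ih G' A' B' L' ?_ I'
    omega

end Main

end SimpleGraph

theorem mainTheorem2 {V : Type u} [Finite V] {C : Type v} (G : SimpleGraph V)
    (hG : SimpleGraph.completeMinorFree 5 G)
    (A B : Set V) (hAB : A ⊆ B) (hA : G.IsClique A)
    (hB : SimpleGraph.IsBoundary (SimpleGraph.completeMinorFree 5) G B)
    (L : V → Set C)
    (hL_one : ∀ x ∈ A, (L x).encard = 1)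
    (hL_ne : ∀ x ∈ A, ∀ y ∈ A, x ≠ y → L x ≠ L y)
    (hL_three : ∀ x ∈ B \ A, 3 ≤ (L x).encard)
    (hL_five : ∀ x ∉ B, 5 ≤ (L x).encard) :
    G.ListColourable L :=
  SimpleGraph.colourableBelow C (Nat.card V + 1) G A B L (Nat.lt_succ_self _)
    ⟨hAB, hA, hB.2, hL_one, hL_ne, fun x hx hxA => hL_three x ⟨hx, hxA⟩, hL_five⟩
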